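/- Let $(W,S)$ be a Coxeter system with length function $\ell$ and Bruhat–Chevalley order $\le$, let $J\subseteq S$, let $W_J=\langle J\rangle$, and let $W^J$ be the set of elements $x\in W$ of minimal length in their coset $W_Jx$. Put $t=q^{1/2}$ and $R=\mathbb Z[t,t^{-1}]$, with the involution $r\mapsto\overline r$ that interchanges $t$ and $t^{-1}$. Let $\mathcal H$ be the Hecke algebra of $W$ over $R$, generated by $T_s$ $(s\in S)$ with the braid relations and $T_s^2=(q-1)T_s+q$; write $T_w=T_{s_1}\cdots T_{s_k}$ for a reduced word $(s_1,\dots,s_k)$ of $w$, and $C'_s=q^{-1/2}(T_e+T_s)$. Let $M=M^J$ be the right $\mathcal H$-module generated by $m_e$ with the relations $m_eT_s=q\,m_e$ $(s\in J)$, so that $m_eT_w=q^{\ell(w)}m_e$ for $w\in W_J$, and put $m_x=m_eT_x$ for $x\in W^J$. Let $m\mapsto\overline m$ be the involution of $M$ with $\overline{m_e}=m_e$, $\overline{rm}=\overline r\,\overline m$ and $\overline{mT_x}=\overline m\,T_{x^{-1}}^{-1}$. For a reduced word $\mathbf s=(s_1,\dots,s_k)$ put ${}^JD'_{\mathbf s}=m_eC'_{s_1}\cdots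 C'_{s_k}$. For $f\in R$ let $f_{\ge0}$ and $f_{>0}$ be the sums of the terms of $f$ of degree $\ge0$ and $>0$ in $t$. Then the elements $m_x/t^{\ell(x)}$, $x\in W^J$, form an $R$-basis of $M$. For each $y\in W^J$ there is a unique element ${}^JC'_y\in M$ that satisfies $\overline{{}^JC'_y}={}^JC'_y$ and has the form $${}^JC'_y=q^{-\ell(y)/2}\sum_{x\in W^J,\;x\le y}P_x(q)\,m_x,$$ with $P_x\in\mathbb Z[q]$, $P_y=1$, and $\deg P_x\le(\ell(y)-\ell(x)-1)/2$ for $x<y$. This element is computed by the following procedure. Algorithm. Choose a reduced word $\mathbf s$ of $y$ and put $F={}^JD'_{\mathbf s}$. While there is an $x\in W^J$ with $x<y$ for which the coefficient of $m_x/t^{\ell(x)}$ in $F$ has a nonzero term of degree $\ge0$ in $t$, choose such an $x$ of maximal length, let $f$ be that coefficient, choose a reduced word $\mathbf s'$ of $x$, and replace $F$ by $$F-\bigl(f_{\ge0}(t)+f_{>0}(t^{-1})\bigr)\,{}^JD'_{\mathbf s'}.$$ For every choice of $\mathbf s$ and all choices of $x$ and $\mathbf s'$ made along the way, the procedure terminates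 after finitely many steps. At every stage it can be continued exactly when such an $x$ exists, and no such $x$ exists if and only if $F={}^JC'_y$; hence the output is exactly ${}^JC'_y$. The procedure uses only the elements ${}^JD'_{\mathbf s'}$, and no Kazhdan–Lusztig basis element other than its output is computed. -/

import Mathlib

open scoped LaurentPolynomial RightActions Polynomial
open MulOpposite

noncomputable section

namespace ParabolicKL

/-! ### The ground ring `R = ℤ[q^{1/2}, q^{-1/2}]` -/

/-- The ring `R = ℤ[t, t⁻¹]`, where `t = q^{1/2}`. -/
abbrev R : Type := ℤ[T;T⁻¹]

/-- The power `t ^ n = q ^ (n / 2)`. -/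
abbrev t (n : ℤ) : R := LaurentPolynomial.T n

/-- The element `q = t ^ 2`. -/
abbrev q : R := t 2

/-- The involution of `R` that interchanges `t` and `t⁻¹`. -/
abbrev barR : R →+* R := (LaurentPolynomial.invert (R := ℤ) : R →+* R)

/-- The part `f_{≥0}` of a Laurent polynomial: its terms of degree `≥ 0`. -/
def nonnegPart (f : R) : R := AddMonoidAlgebra.ofCoeff (f.coeff.filter (fun n : ℤ => 0 ≤ n))

/-- The part `f_{>0}` of a Laurent polynomial: its terms of degree `> 0`. -/
def posPart (f : R) : R := AddMonoidAlgebra.ofCoeff (f.coeff.filter (fun n : ℤ => 0 < n))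

/-- The correction factor `f_{≥0}(t) + f_{>0}(t⁻¹)`. -/
def symPart (f : R) : R := nonnegPart f + barR (posPart f)

/-! ### The Hecke algebra -/

variable {B W : Type*} [Group W]

/-- The defining relations of the Hecke algebra: the quadratic relations
`T_s ^ 2 = (q - 1) T_s + q` and the braid relations (there is no condition when `M i j = 0`,
that is, when `s_i s_j` has infinite order). -/
inductive HeckeRel (M : CoxeterMatrix B) : FreeAlgebra R B → FreeAlgebra R B → Prop
  | quadratic (i : B) :
      HeckeRel M (FreeAlgebra.ι R i * FreeAlgebra.ι R i)
        ((q - 1) • FreeAlgebra.ι R i + q • (1 : FreeAlgebra R B))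
  | braid (i j : B) :
      HeckeRel M ((CoxeterSystem.braidWord M i j).map (FreeAlgebra.ι R)).prod
        ((CoxeterSystem.braidWord M j i).map (FreeAlgebra.ι R)).prod

/-- The Hecke algebra of the Coxeter group with Coxeter matrix `M`, over `R`. -/
def Hecke (M : CoxeterMatrix B) : Type _ := RingQuot (HeckeRel M)

instance (M : CoxeterMatrix B) : Semiring (Hecke M) :=
  inferInstanceAs (Semiring (RingQuot (HeckeRel M)))

instance (M : CoxeterMatrix B) : Algebra R (Hecke M) :=
  inferInstanceAs (Algebra R (RingQuot (HeckeRel M)))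

instance (M : CoxeterMatrix B) : Ring (Hecke M) := Algebra.semiringToRing R

/-- The quotient map from the free algebra to the Hecke algebra. -/
def Hecke.mk (M : CoxeterMatrix B) : FreeAlgebra R B →ₐ[R] Hecke M :=
  RingQuot.mkAlgHom R (HeckeRel M)

theorem Hecke.mk_rel {M : CoxeterMatrix B} {x y : FreeAlgebra R B} (h : HeckeRel M x y) :
    Hecke.mk M x = Hecke.mk M y :=
  RingQuot.mkAlgHom_rel R h

/-- The generator `T_s` of the Hecke algebra, for a simple reflection `s = s_i`. -/
def Tgen (M : CoxeterMatrix B) (i : B) : Hecke M :=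
  Hecke.mk M (FreeAlgebra.ι R i)

/-- The element `C'_s = q^{-1/2} (T_e + T_s)`. -/
def Cgen (M : CoxeterMatrix B) (i : B) : Hecke M := t (-1) • (1 + Tgen M i)

/-- The standard basis element `T_w = T_{s_1} ⋯ T_{s_k}`, for a reduced word `(s_1, …, s_k)`
of `w`. -/
def Tstd {M : CoxeterMatrix B} (cs : CoxeterSystem M W) (w : W) : Hecke M :=
  ((cs.exists_isReduced w).choose.map (Tgen M)).prod

theorem t_mul_t (a b : ℤ) : t a * t b = t (a + b) := (LaurentPolynomial.T_add a b).symm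

theorem t_zero : t 0 = 1 := LaurentPolynomial.T_zero

theorem q_inv_mul : t (-2) * q = 1 := by rw [q, t_mul_t]; exact t_zero

theorem Tgen_mul_self (M : CoxeterMatrix B) (i : B) :
    Tgen M i * Tgen M i = (q - 1) • Tgen M i + q • (1 : Hecke M) := by
  have h := Hecke.mk_rel (HeckeRel.quadratic (M := M) i)
  rwa [map_mul, map_add, map_smul, map_smul, map_one] at h

theorem Tgen_braid (M : CoxeterMatrix B) (i j : B) :
    ((CoxeterSystem.braidWord M i j).map (Tgen M)).prod =
      ((CoxeterSystem.braidWord M j i).map (Tgen M)).prod := by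
  have h := Hecke.mk_rel (HeckeRel.braid (M := M) i j)
  rw [map_list_prod, map_list_prod, List.map_map, List.map_map] at h
  exact h

/-- The inverse `T_s⁻¹ = q⁻¹ T_s - (1 - q⁻¹)`. -/
def TgenInv (M : CoxeterMatrix B) (i : B) : Hecke M :=
  t (-2) • Tgen M i - (1 - t (-2)) • (1 : Hecke M)

theorem Tgen_mul_inv (M : CoxeterMatrix B) (i : B) : Tgen M i * TgenInv M i = 1 := by
  rw [TgenInv, mul_sub, mul_smul_comm, Tgen_mul_self, mul_smul_comm, mul_one, smul_add, smul_smul,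
    smul_smul, q_inv_mul, mul_sub, q_inv_mul, mul_one, one_smul, add_sub_cancel_left]

theorem Tgen_inv_mul (M : CoxeterMatrix B) (i : B) : TgenInv M i * Tgen M i = 1 := by
  rw [TgenInv, sub_mul, smul_mul_assoc, Tgen_mul_self, smul_mul_assoc, one_mul, smul_add, smul_smul,
    smul_smul, q_inv_mul, mul_sub, q_inv_mul, mul_one, one_smul, add_sub_cancel_left]

/-- `T_s` as a unit of the Hecke algebra. -/
def Tunit (M : CoxeterMatrix B) (i : B) : (Hecke M)ˣ :=
  ⟨Tgen M i, TgenInv M i, Tgen_mul_inv M i, Tgen_inv_mul M i⟩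

/-! ### The bar involution of the Hecke algebra -/

theorem alternatingWord_reverse (i j : B) (m : ℕ) :
    (CoxeterSystem.alternatingWord i j m).reverse =
      if Even m then CoxeterSystem.alternatingWord j i m
      else CoxeterSystem.alternatingWord i j m := by
  induction m generalizing i j with
  | zero => simp [CoxeterSystem.alternatingWord]
  | succ m ih =>
    have h : ((CoxeterSystem.alternatingWord j i m).concat j).reverse =
        j :: (CoxeterSystem.alternatingWord j i m).reverse := by simp
    rw [CoxeterSystem.alternatingWord_succ, h, ih]
    by_cases hm : Even m
    · have hm' : ¬ Even (m + 1) := by simpa [Nat.even_add_one] using hm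
      rw [if_pos hm, if_neg hm', ← CoxeterSystem.alternatingWord_succ,
        CoxeterSystem.alternatingWord_succ', if_pos hm]
    · have hm' : Even (m + 1) := Nat.even_add_one.mpr hm
      rw [if_neg hm, if_pos hm', CoxeterSystem.alternatingWord_succ', if_neg hm]

theorem TgenInv_braid (M : CoxeterMatrix B) (i j : B) :
    ((CoxeterSystem.braidWord M i j).map (TgenInv M)).prod =
      ((CoxeterSystem.braidWord M j i).map (TgenInv M)).prod := by
  have hu : ((CoxeterSystem.braidWord M i j).map (Tunit M)).prod =
      ((CoxeterSystem.braidWord M j i).map (Tunit M)).prod := by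
    apply Units.ext
    have h := Tgen_braid M i j
    rw [← Units.coeHom_apply, ← Units.coeHom_apply, map_list_prod, map_list_prod, List.map_map,
      List.map_map]
    exact h
  have key : ∀ l : List B, (l.map (TgenInv M)).prod =
      ((((l.reverse.map (Tunit M)).prod)⁻¹ : (Hecke M)ˣ) : Hecke M) := by
    intro l
    induction l with
    | nil => simp
    | cons a l ih =>
      simp only [List.map_cons, List.prod_cons, List.reverse_cons, List.map_append,
        List.prod_append, List.map_nil, List.prod_nil, mul_one, mul_inv_rev, Units.val_mul, ih]
      rfl
  rw [key, key, CoxeterSystem.braidWord, CoxeterSystem.braidWord, alternatingWord_reverse,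
    alternatingWord_reverse, M.symmetric j i]
  rw [CoxeterSystem.braidWord, CoxeterSystem.braidWord, M.symmetric j i] at hu
  split_ifs <;> simp only [hu]

/-- The Hecke algebra as an `R`-algebra through the involution of `R`. -/
abbrev twistedAlgebra (M : CoxeterMatrix B) : Algebra R (Hecke M) :=
  ((algebraMap R (Hecke M)).comp barR).toAlgebra' fun c x => Algebra.commutes (barR c) x

/-- The ring homomorphism on the free algebra with `r ↦ bar r` and `T_s ↦ T_s⁻¹`. -/
def barFree (M : CoxeterMatrix B) : FreeAlgebra R B →+* Hecke M :=
  letI := twistedAlgebra M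
  (FreeAlgebra.lift R (TgenInv M)).toRingHom

theorem barFree_ι (M : CoxeterMatrix B) (i : B) :
    barFree M (FreeAlgebra.ι R i) = TgenInv M i :=
  letI := twistedAlgebra M
  FreeAlgebra.lift_ι_apply (TgenInv M) i

theorem barFree_algebraMap (M : CoxeterMatrix B) (r : R) :
    barFree M (algebraMap R (FreeAlgebra R B) r) = algebraMap R (Hecke M) (barR r) :=
  letI := twistedAlgebra M
  (FreeAlgebra.lift R (TgenInv M)).commutes r

theorem barFree_smul (M : CoxeterMatrix B) (r : R) (x : FreeAlgebra R B) :
    barFree M (r • x) = barR r • barFree M x := by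
  rw [Algebra.smul_def, map_mul, barFree_algebraMap, ← Algebra.smul_def]

theorem barR_t (n : ℤ) : barR (t n) = t (-n) := LaurentPolynomial.invert_T n

theorem TgenInv_mul_self (M : CoxeterMatrix B) (i : B) :
    TgenInv M i * TgenInv M i = (t (-2) - 1) • TgenInv M i + t (-2) • (1 : Hecke M) := by
  have h : TgenInv M i * TgenInv M i =
      t (-2) • (TgenInv M i * Tgen M i) - (1 - t (-2)) • TgenInv M i := by
    nth_rw 2 [TgenInv]
    rw [mul_sub, mul_smul_comm, mul_smul_comm, mul_one]
  rw [h, Tgen_inv_mul, sub_smul, sub_smul]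
  abel

theorem barFree_rel (M : CoxeterMatrix B) ⦃x y : FreeAlgebra R B⦄ (h : HeckeRel M x y) :
    barFree M x = barFree M y := by
  cases h with
  | quadratic i =>
    rw [map_mul, map_add, barFree_smul, barFree_smul, barFree_ι, map_one, map_sub, barR_t,
      map_one, TgenInv_mul_self]
  | braid i j =>
    rw [map_list_prod, map_list_prod, List.map_map, List.map_map]
    have : (barFree M : FreeAlgebra R B → Hecke M) ∘ FreeAlgebra.ι R = TgenInv M :=
      funext (barFree_ι M)
    rw [this, TgenInv_braid]

/-- The bar involution of the Hecke algebra: the ring homomorphism that extends the involution of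
`R` and sends `T_s` to `T_s⁻¹`; it sends `T_w` to `(T_{w⁻¹})⁻¹`. -/
def barH (M : CoxeterMatrix B) : Hecke M →+* Hecke M :=
  RingQuot.lift ⟨barFree M, barFree_rel M⟩

theorem barH_mk (M : CoxeterMatrix B) (x : FreeAlgebra R B) :
    barH M (Hecke.mk M x) = barFree M x := by
  have e : Hecke.mk M x = RingQuot.mkRingHom (HeckeRel M) x := by
    rw [← RingQuot.mkAlgHom_coe R]; rfl
  rw [e]
  exact RingQuot.lift_mkRingHom_apply (barFree M) (barFree_rel M) x

theorem barH_Tgen (M : CoxeterMatrix B) (i : B) : barH M (Tgen M i) = TgenInv M i := by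
  rw [Tgen, barH_mk, barFree_ι]

theorem barH_smul (M : CoxeterMatrix B) (r : R) (h : Hecke M) :
    barH M (r • h) = barR r • barH M h := by
  rw [Algebra.smul_def, map_mul, ← AlgHom.commutes (Hecke.mk M), barH_mk, barFree_algebraMap,
    ← Algebra.smul_def]

/-! ### Distinguished coset representatives and the Bruhat order -/

/-- The parabolic subgroup `W_J`. -/
def parabolic {M : CoxeterMatrix B} (cs : CoxeterSystem M W) (J : Set B) : Subgroup W :=
  Subgroup.closure (cs.simple '' J)

/-- The set `W^J` of the elements `x` of `W` that are shortest in their coset `W_J x`. -/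
def minReps {M : CoxeterMatrix B} (cs : CoxeterSystem M W) (J : Set B) : Set W :=
  {x | ∀ w ∈ parabolic cs J, cs.length x ≤ cs.length (w * x)}

/-- The Bruhat–Chevalley order `x ≤ y`: there is a chain from `x` to `y` in which each step is
multiplication by a reflection that increases the length. -/
def BruhatLE {M : CoxeterMatrix B} (cs : CoxeterSystem M W) (x y : W) : Prop :=
  Relation.ReflTransGen
    (fun u v : W => ∃ r : W, cs.IsReflection r ∧ v = u * r ∧ cs.length u < cs.length v) x y

/-- The strict Bruhat–Chevalley order. -/
def BruhatLT {M : CoxeterMatrix B} (cs : CoxeterSystem M W) (x y : W) : Prop :=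
  BruhatLE cs x y ∧ x ≠ y

/-! ### The right module `M^J` -/

/-- The right ideal of the Hecke algebra generated by the elements `T_s - q`, `s ∈ J`. -/
def rightIdeal (M : CoxeterMatrix B) (J : Set B) : Submodule (Hecke M)ᵐᵒᵖ (Hecke M) :=
  Submodule.span (Hecke M)ᵐᵒᵖ ((fun i => Tgen M i - q • (1 : Hecke M)) '' J)

/-- The right module `M^J`: it is induced from the rank one right module of the Hecke algebra of
`W_J` on which `T_w` acts as `q ^ ℓ(w)`. In other words, it is generated by one element `m_e`
with the defining relations `m_e T_s = q m_e` for `s ∈ J`. -/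
abbrev ParMod (M : CoxeterMatrix B) (J : Set B) : Type _ := Hecke M ⧸ rightIdeal M J

/-- The generator `m_e` of `M^J`. -/
def mOne (M : CoxeterMatrix B) (J : Set B) : ParMod M J := Submodule.Quotient.mk 1

/-- The element `m_x = m_e T_x`. -/
def mStd {M : CoxeterMatrix B} (cs : CoxeterSystem M W) (J : Set B) (x : W) : ParMod M J :=
  mOne M J <• Tstd cs x

theorem barH_mem (M : CoxeterMatrix B) (J : Set B) :
    (rightIdeal M J).toAddSubgroup ≤
      (rightIdeal M J).toAddSubgroup.comap (barH M : Hecke M →+ Hecke M) := by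
  intro h hh
  change barH M h ∈ rightIdeal M J
  replace hh : h ∈ rightIdeal M J := hh
  induction hh using Submodule.span_induction with
  | mem x hx =>
    obtain ⟨i, hi, rfl⟩ := hx
    have hg : Tgen M i - q • (1 : Hecke M) ∈ rightIdeal M J := Submodule.subset_span ⟨i, hi, rfl⟩
    have e : barH M (Tgen M i - q • (1 : Hecke M)) =
        op (-(t (-2) • TgenInv M i)) • (Tgen M i - q • (1 : Hecke M)) := by
      rw [map_sub, barH_smul, barH_Tgen, map_one, barR_t, op_smul_eq_mul, mul_neg, mul_smul_comm,
        sub_mul, Tgen_mul_inv, smul_mul_assoc, one_mul, smul_sub, smul_smul, q_inv_mul, one_smul,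
        neg_sub]
    change barH M (Tgen M i - q • (1 : Hecke M)) ∈ _
    rw [e]
    exact Submodule.smul_mem _ _ hg
  | zero => rw [map_zero]; exact Submodule.zero_mem _
  | add x y _ _ hx hy => rw [map_add]; exact Submodule.add_mem _ hx hy
  | smul a x _ hx =>
    have e : barH M (a • x) = op (barH M a.unop) • barH M x := by
      rw [← op_unop a, op_smul_eq_mul, map_mul, op_smul_eq_mul, unop_op]
    rw [e]
    exact Submodule.smul_mem _ _ hx

/-- The bar involution of `M^J`, induced by that of the Hecke algebra. -/
def barM (M : CoxeterMatrix B) (J : Set B) : ParMod M J →+ ParMod M J :=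
  QuotientAddGroup.map (rightIdeal M J).toAddSubgroup (rightIdeal M J).toAddSubgroup
    (barH M : Hecke M →+ Hecke M) (barH_mem M J)

theorem barM_mk (M : CoxeterMatrix B) (J : Set B) (h : Hecke M) :
    barM M J (Submodule.Quotient.mk h) = Submodule.Quotient.mk (barH M h) := rfl

/-- The bar involution of `M^J` fixes `m_e`; the next two facts say that it is semilinear and that
it is compatible with the action of the Hecke algebra. -/
theorem barM_mOne (M : CoxeterMatrix B) (J : Set B) : barM M J (mOne M J) = mOne M J := by
  rw [mOne, barM_mk, map_one]

theorem barM_smul (M : CoxeterMatrix B) (J : Set B) (r : R) (m : ParMod M J) :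
    barM M J (r • m) = barR r • barM M J m := by
  obtain ⟨h, rfl⟩ := Submodule.Quotient.mk_surjective _ m
  rw [← Submodule.Quotient.mk_smul, barM_mk, barM_mk, barH_smul, Submodule.Quotient.mk_smul]

theorem barM_act (M : CoxeterMatrix B) (J : Set B) (m : ParMod M J) (h : Hecke M) :
    barM M J (m <• h) = barM M J m <• barH M h := by
  obtain ⟨k, rfl⟩ := Submodule.Quotient.mk_surjective _ m
  rw [← Submodule.Quotient.mk_smul, barM_mk, barM_mk, ← Submodule.Quotient.mk_smul,
    op_smul_eq_mul, op_smul_eq_mul, map_mul]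

/-! ### Kazhdan–Lusztig basis elements and the algorithm -/

section Algorithm

variable {M : CoxeterMatrix B} (cs : CoxeterSystem M W) (J : Set B)

/-- `C` is a parabolic Kazhdan–Lusztig basis element for `y ∈ W^J`: it is fixed by the bar
involution, and `C = q^{-ℓ(y)/2} ∑_{x ≤ y} P_x(q) m_x` for integer polynomials `P_x` with
`P_y = 1` and `deg P_x ≤ (ℓ(y) - ℓ(x) - 1) / 2` for `x < y`. -/
def IsKLElement (y : minReps cs J) (C : ParMod M J) : Prop :=
  barM M J C = C ∧
    ∃ P : minReps cs J →₀ ℤ[X],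
      (∀ x, P x ≠ 0 → BruhatLE cs (x : W) y) ∧
      P y = 1 ∧
      (∀ x : minReps cs J, BruhatLT cs (x : W) y →
        2 * (P x).natDegree + cs.length (x : W) + 1 ≤ cs.length (y : W)) ∧
      C = t (-(cs.length (y : W) : ℤ)) •
        P.sum fun x p => (Polynomial.aeval q p : R) • mStd cs J (x : W)

/-- The element `D'_s = m_e C'_{s_1} ⋯ C'_{s_k}` for a word `s = (s_1, …, s_k)`. -/
def Dword (M : CoxeterMatrix B) (J : Set B) (s : List B) : ParMod M J :=
  s.foldl (fun m i => m <• Cgen M i) (mOne M J)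

variable {cs J}
variable (b : Module.Basis (minReps cs J) R (ParMod M J)) (y : minReps cs J)

/-- With respect to the basis `b`, the element `x < y` has in `F` a coefficient with a nonzero term
of nonnegative degree in `t`. -/
def Offending (F : ParMod M J) (x : minReps cs J) : Prop :=
  BruhatLT cs (x : W) y ∧ ∃ n : ℤ, 0 ≤ n ∧ (b.repr F x).coeff n ≠ 0

/-- One reassignment `F ↦ F'` of the algorithm that targets `y`: choose an offending `x` of maximal
length and a reduced word `s` for `x`, and subtract `(f_{≥0}(t) + f_{>0}(t⁻¹)) D'_s`, where `f` is
the coefficient at `x`. -/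
def Step (F F' : ParMod M J) : Prop :=
  ∃ x : minReps cs J, Offending b y F x ∧
    (∀ z : minReps cs J, Offending b y F z → cs.length (z : W) ≤ cs.length (x : W)) ∧
    ∃ s : List B, cs.IsReduced s ∧ cs.wordProd s = x ∧
      F' = F - symPart (b.repr F x) • Dword M J s

end Algorithm

end ParabolicKL

end

/-! ### The exchange condition -/

namespace CoxeterSystem

variable {B W : Type*} [Group W] {M : CoxeterMatrix B} (cs : CoxeterSystem M W)

/-! The argument rests on two triangularities with respect to length. For a reduced word of `x`, the
element `Dword` is fixed by the bar involution and equals `m_x / t^ℓ(x)` plus terms of smaller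
length (`Dword_sub_hStd_mem`). Hence the bar involution is itself unitriangular on the normalized
standard basis, and a bar-fixed element all of whose coefficients have only negative degrees must
vanish (`eq_zero_of_barM_eq`). This gives uniqueness of the Kazhdan–Lusztig element.

Every element met by the procedure is a stage (`IsStage`): bar-fixed, with coefficient 1 at `y`,
supported below `y`, and with exponents at `x` of the parity of `ℓ(y) - ℓ(x)` and bounded by it in
absolute value. A step cancels all terms of nonnegative degree at one `x` and alters no other
coefficient at length at least `ℓ(x)`, so the finite multiset of offending lengths decreases in the
Dershowitz–Manna order. A stage without offending coefficients satisfies the degree bounds of a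
Kazhdan–Lusztig element, and the parity condition turns its coefficients into polynomials in `q`.
Existence follows from a stage that is minimal for the well-founded step relation, and independence
of all choices follows from uniqueness.

The basis property needs Coxeter group theory: the strong exchange condition, Matsumoto's theorem
(so that `T_w` is independent of the reduced word), Deodhar's lemma, and a faithful enough model,
namely the left regular representation on the free module over `W`. A functional on that model
yields functionals on `M^J` that separate the standard elements. -/

theorem prod_map_alternatingWord_two_mul {G : Type*} [Monoid G] (f : B → G) (i j : B) (m : ℕ) :
    ((alternatingWord i j (2 * m)).map f).prod = (f i * f j) ^ m := by
  induction m with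
  | zero => simp [alternatingWord]
  | succ m ih =>
    rw [Nat.mul_succ, alternatingWord, alternatingWord]
    simp [ih, pow_succ]

theorem end_mul_apply {α : Type*} (f g : Function.End α) (a : α) : (f * g) a = f (g a) := rfl

open Classical in
/-- The action of a simple reflection on pairs of a group element and a sign, in which the sign
changes exactly at the simple reflection itself. -/
noncomputable def signStep (i : B) : Function.End (W × ZMod 2) := fun p =>
  (cs.simple i * p.1 * cs.simple i, p.2 + if p.1 = cs.simple i then 1 else 0)

open Classical in
theorem prod_map_signStep (ω : List B) (r : W) (ε : ZMod 2) :
    (ω.map cs.signStep).prod (r, ε) =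
      (cs.wordProd ω * r * (cs.wordProd ω)⁻¹, ε + ((cs.rightInvSeq ω).count r : ℕ)) := by
  induction ω with
  | nil => simp [Function.End.one_def]
  | cons i ω ih =>
    rw [List.map_cons, List.prod_cons, end_mul_apply, ih, signStep,
      rightInvSeq, List.count_cons, wordProd_cons]
    refine Prod.ext (by simp [mul_assoc]) ?_
    have : cs.wordProd ω * r * (cs.wordProd ω)⁻¹ = cs.simple i ↔
        (cs.wordProd ω)⁻¹ * cs.simple i * cs.wordProd ω = r := by
      constructor <;> (intro h; rw [← h]; group)
    simp only [this, beq_iff_eq, Nat.cast_add, add_assoc]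
    split_ifs <;> simp

/-- The second half of the inversion sequence of `(s_i s_j)^m` repeats the first half, because `(s_i
s_j)^m = 1`. Each reflection therefore occurs an even number of times and no sign changes. -/
theorem isLiftable_signStep : M.IsLiftable cs.signStep := by
  classical
  intro i j
  rw [← prod_map_alternatingWord_two_mul]
  funext ⟨r, ε⟩
  rw [prod_map_signStep]
  have h1 : cs.wordProd (alternatingWord i j (2 * M i j)) = 1 := by
    rw [wordProd, prod_map_alternatingWord_two_mul, simple_mul_simple_pow]
  have h2 : (cs.rightInvSeq (alternatingWord i j (2 * M i j))).count r =
      (cs.leftInvSeq (alternatingWord j i (2 * M i j))).count r := by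
    rw [← List.count_reverse, ← leftInvSeq_reverse, ParabolicKL.alternatingWord_reverse,
      if_pos (even_two_mul _)]
  set p := M i j with hp
  set l := cs.leftInvSeq (alternatingWord j i (2 * p)) with hl
  have h3 : l.drop p = l.take p := by
    refine List.ext_getElem (by simp [hl]; omega) fun k hk hk' => ?_
    have hk2 : k < p := by simp at hk'; omega
    rw [List.getElem_drop, List.getElem_take]
    simp only [hl]
    rw [getElem_leftInvSeq_alternatingWord _ _ _ _ _ (by omega),
      getElem_leftInvSeq_alternatingWord _ _ _ _ _ (by omega),
      prod_alternatingWord_eq_mul_pow, prod_alternatingWord_eq_mul_pow,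
      if_neg (by simp), if_neg (by simp), show (2 * (p + k) + 1) / 2 = p + k by omega,
      show (2 * k + 1) / 2 = k by omega, pow_add, hp, simple_mul_simple_pow, one_mul]
  have h4 : l.count r = (l.take p).count r + (l.take p).count r := by
    conv_lhs => rw [← List.take_append_drop p l, List.count_append, h3]
  have h5 : ((l.count r : ℕ) : ZMod 2) = 0 := by
    rw [h4, ← two_mul, Nat.cast_mul]
    have : ((2 : ℕ) : ZMod 2) = 0 := rfl
    rw [this, zero_mul]
  simp [h1, h2, h5, Function.End.one_def]

/-- The action of `W` on pairs of a group element and a sign. -/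
noncomputable def signHom : W →* Function.End (W × ZMod 2) :=
  cs.lift ⟨cs.signStep, cs.isLiftable_signStep⟩

theorem signHom_wordProd (ω : List B) :
    cs.signHom (cs.wordProd ω) = (ω.map cs.signStep).prod := by
  rw [wordProd, map_list_prod, List.map_map]
  congr 2
  funext i
  exact cs.lift_apply_simple cs.isLiftable_signStep i

/-- The parity of the number of occurrences of `r` in the inversion sequence of a word for `w`. -/
noncomputable def inversionParity (w r : W) : ZMod 2 := (cs.signHom w (r, 0)).2

open Classical in
theorem inversionParity_wordProd (ω : List B) (r : W) :
    cs.inversionParity (cs.wordProd ω) r = ((cs.rightInvSeq ω).count r : ℕ) := by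
  rw [inversionParity, signHom_wordProd, prod_map_signStep, zero_add]

theorem signHom_apply (w r : W) (ε : ZMod 2) :
    cs.signHom w (r, ε) = (w * r * w⁻¹, ε + cs.inversionParity w r) := by
  classical
  obtain ⟨ω, rfl⟩ := cs.wordProd_surjective w
  rw [signHom_wordProd, prod_map_signStep, inversionParity_wordProd]

theorem inversionParity_mul (v w r : W) :
    cs.inversionParity (v * w) r =
      cs.inversionParity w r + cs.inversionParity v (w * r * w⁻¹) := by
  rw [inversionParity, map_mul, end_mul_apply, signHom_apply,
    signHom_apply, zero_add]

theorem inversionParity_one (r : W) : cs.inversionParity 1 r = 0 := by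
  rw [inversionParity, map_one]; rfl

theorem inversionParity_simple (i : B) : cs.inversionParity (cs.simple i) (cs.simple i) = 1 := by
  classical
  rw [← wordProd_singleton, inversionParity_wordProd]
  simp

/-- In the cocycle expansion of `w s w⁻¹`, the contributions of `w` and `w⁻¹` are the same as in the
expansion of `w w⁻¹ = 1`, so they cancel and only the contribution 1 of `s` remains. -/
theorem IsReflection.inversionParity_self {r : W} (hr : cs.IsReflection r) :
    cs.inversionParity r r = 1 := by
  obtain ⟨w, i, rfl⟩ := hr
  have h1 : cs.inversionParity (w * cs.simple i * w⁻¹) (w * cs.simple i * w⁻¹) =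
      cs.inversionParity w⁻¹ (w * cs.simple i * w⁻¹) + (cs.inversionParity (cs.simple i)
        (cs.simple i) + cs.inversionParity w (cs.simple i)) := by
    rw [inversionParity_mul, inversionParity_mul]
    congr 2 <;> simp [mul_assoc]
  have h2 : cs.inversionParity (w * w⁻¹) (w * cs.simple i * w⁻¹) =
      cs.inversionParity w⁻¹ (w * cs.simple i * w⁻¹) + cs.inversionParity w (cs.simple i) := by
    rw [inversionParity_mul]
    congr 2
    simp [mul_assoc]
  rw [mul_inv_cancel, inversionParity_one] at h2
  rw [h1, inversionParity_simple, add_left_comm, ← h2, add_zero]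

theorem mem_rightInvSeq_of_inversionParity {ω : List B} {r : W}
    (h : cs.inversionParity (cs.wordProd ω) r ≠ 0) : r ∈ cs.rightInvSeq ω := by
  classical
  rw [inversionParity_wordProd] at h
  by_contra h'
  exact h (by rw [List.count_eq_zero_of_not_mem h', Nat.cast_zero])

theorem length_mul_lt_of_inversionParity {w r : W} (h : cs.inversionParity w r ≠ 0) :
    cs.length (w * r) < cs.length w := by
  obtain ⟨ω, hω, rfl⟩ := cs.exists_isReduced w
  exact (cs.isRightInversion_of_mem_rightInvSeq hω (cs.mem_rightInvSeq_of_inversionParity h)).2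

theorem inversionParity_ne_zero_iff {w r : W} (hr : cs.IsReflection r) :
    cs.inversionParity w r ≠ 0 ↔ cs.length (w * r) < cs.length w := by
  refine ⟨cs.length_mul_lt_of_inversionParity, fun h h0 => ?_⟩
  -- Passing from `w` to `w r` flips the parity at `r`, so parity 0 for `w` would make `w r` longer
  -- than `w`.
  have h1 : cs.inversionParity (w * r) r ≠ 0 := by
    rw [inversionParity_mul, IsReflection.inversionParity_self cs hr, mul_inv_cancel_right, h0]
    decide
  have h2 := cs.length_mul_lt_of_inversionParity h1
  rw [mul_assoc, hr.mul_self, mul_one] at h2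
  omega

/-- The strong exchange condition. -/
theorem strong_exchange {ω : List B} {r : W} (hr : cs.IsReflection r)
    (h : cs.length (cs.wordProd ω * r) < cs.length (cs.wordProd ω)) :
    ∃ k < ω.length, cs.wordProd ω * r = cs.wordProd (ω.eraseIdx k) := by
  have hm := cs.mem_rightInvSeq_of_inversionParity ((cs.inversionParity_ne_zero_iff hr).2 h)
  obtain ⟨k, hk, rfl⟩ := List.mem_iff_getElem.mp hm
  refine ⟨k, by simpa using hk, ?_⟩
  rw [← List.getD_eq_getElem _ 1 hk, wordProd_mul_getD_rightInvSeq]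

theorem exchange_right {ω : List B} {i : B}
    (h : cs.length (cs.wordProd ω * cs.simple i) < cs.length (cs.wordProd ω)) :
    ∃ k < ω.length, cs.wordProd ω * cs.simple i = cs.wordProd (ω.eraseIdx k) :=
  cs.strong_exchange (cs.isReflection_simple i) h

theorem exchange_left {ω : List B} {i : B}
    (h : cs.length (cs.simple i * cs.wordProd ω) < cs.length (cs.wordProd ω)) :
    ∃ k < ω.length, cs.simple i * cs.wordProd ω = cs.wordProd (ω.eraseIdx k) := by
  have h' : cs.length (cs.wordProd ω.reverse * cs.simple i) < cs.length (cs.wordProd ω.reverse) := by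
    rwa [wordProd_reverse, length_inv, ← length_inv, mul_inv_rev, inv_simple, inv_inv]
  have hm := cs.mem_rightInvSeq_of_inversionParity
    ((cs.inversionParity_ne_zero_iff (cs.isReflection_simple i)).2 h')
  rw [rightInvSeq_reverse, List.mem_reverse] at hm
  obtain ⟨k, hk, e⟩ := List.mem_iff_getElem.mp hm
  refine ⟨k, by simpa using hk, ?_⟩
  rw [← getD_leftInvSeq_mul_wordProd, List.getD_eq_getElem _ 1 hk, e]

/-- A reflection that occurs once has odd parity, and parity depends only on the group element. All
these reflections therefore occur in the inversion sequence of a reduced word too, which cannot be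
shorter. -/
theorem isReduced_of_nodup_rightInvSeq {ω : List B} (h : (cs.rightInvSeq ω).Nodup) :
    cs.IsReduced ω := by
  classical
  refine le_antisymm (cs.length_wordProd_le ω) ?_
  obtain ⟨ω', hω', e⟩ := cs.exists_isReduced (cs.wordProd ω)
  have hsub : cs.rightInvSeq ω ⊆ cs.rightInvSeq ω' := by
    intro r hr
    apply cs.mem_rightInvSeq_of_inversionParity
    rw [← e, inversionParity_wordProd, List.count_eq_one_of_mem h hr]
    decide
  have := (h.subperm hsub).length_le
  rw [length_rightInvSeq, length_rightInvSeq] at this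
  rw [e, hω'.eq]
  exact this

theorem IsReduced.of_append_left {cs : CoxeterSystem M W} {ω ω' : List B}
    (h : cs.IsReduced (ω ++ ω')) : cs.IsReduced ω := by
  simpa using h.take ω.length

theorem IsReduced.of_append_right {cs : CoxeterSystem M W} {ω ω' : List B}
    (h : cs.IsReduced (ω ++ ω')) : cs.IsReduced ω' := by
  simpa using h.drop ω.length

theorem length_wordProd_eraseIdx_le (ω : List B) {k : ℕ} (hk : k < ω.length) :
    cs.length (cs.wordProd (ω.eraseIdx k)) + 1 ≤ ω.length := by
  rw [← List.length_eraseIdx_add_one hk]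
  exact Nat.add_le_add_right (cs.length_wordProd_le _) 1

end CoxeterSystem

/-! ### The order of a product of two simple reflections -/

namespace CoxeterSystem

variable {B W : Type*} [Group W] {M : CoxeterMatrix B} (cs : CoxeterSystem M W)

/-- The angle `π / m`, which is `0` for `m = 0`. -/
noncomputable def coxeterAngle (M : CoxeterMatrix B) (i j : B) : ℝ := Real.pi / M i j

/-- The linear functional `2 B(α_i, ·)` of the geometric representation. -/
noncomputable def geomCoroot (M : CoxeterMatrix B) (i : B) : Module.Dual ℝ (B →₀ ℝ) :=
  Finsupp.lsum ℝ fun j => (-2 * Real.cos (coxeterAngle M i j)) • LinearMap.id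

theorem geomCoroot_single (M : CoxeterMatrix B) (i j : B) :
    geomCoroot M i (Finsupp.single j 1) = -2 * Real.cos (coxeterAngle M i j) := by
  simp [geomCoroot]

theorem geomCoroot_self (M : CoxeterMatrix B) (i : B) :
    geomCoroot M i (Finsupp.single i 1) = 2 := by
  simp [geomCoroot_single, coxeterAngle]

/-- The reflections of the geometric representation. -/
noncomputable def geomReflection (M : CoxeterMatrix B) (i : B) : (B →₀ ℝ) ≃ₗ[ℝ] (B →₀ ℝ) :=
  Module.reflection (geomCoroot_self M i)

theorem geomCoroot_mul (M : CoxeterMatrix B) (i j : B) :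
    geomCoroot M i (Finsupp.single j 1) * geomCoroot M j (Finsupp.single i 1) - 2 =
      2 * Real.cos (2 * coxeterAngle M i j) := by
  rw [geomCoroot_single, geomCoroot_single, coxeterAngle, coxeterAngle, M.symmetric j i,
    Real.cos_two_mul]
  ring

open Polynomial.Chebyshev in
theorem geomReflection_pow_apply (M : CoxeterMatrix B) (i j : B) (k : ℕ) :
    ((geomReflection M i * geomReflection M j) ^ k) (Finsupp.single i 1) =
      ((S ℝ k).eval (2 * Real.cos (2 * coxeterAngle M i j)) +
        (S ℝ (k - 1)).eval (2 * Real.cos (2 * coxeterAngle M i j))) • Finsupp.single i 1 +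
      ((S ℝ (k - 1)).eval (2 * Real.cos (2 * coxeterAngle M i j)) *
        (2 * Real.cos (coxeterAngle M i j))) • Finsupp.single j 1 := by
  have := Module.reflection_mul_reflection_pow_apply_self (geomCoroot_self M i)
    (geomCoroot_self M j) k _ (geomCoroot_mul M i j).symm
  have hs : coxeterAngle M j i = coxeterAngle M i j := by
    rw [coxeterAngle, coxeterAngle, M.symmetric]
  rw [geomReflection, geomReflection, this, geomCoroot_single M j i, hs, neg_mul,
    neg_neg]

theorem two_le_of_ne {i j : B} (h : i ≠ j) (h0 : M i j ≠ 0) : 2 ≤ M i j := by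
  have := M.off_diagonal i j h
  omega

theorem sin_two_mul_coxeterAngle_ne_zero {i j : B} (h : 3 ≤ M i j) :
    Real.sin (2 * coxeterAngle M i j) ≠ 0 := by
  have h3 : (3 : ℝ) ≤ M i j := by exact_mod_cast h
  refine (Real.sin_pos_of_pos_of_lt_pi ?_ ?_).ne'
  · have := Real.pi_pos
    unfold coxeterAngle
    positivity
  · rw [coxeterAngle, mul_div_assoc', div_lt_iff₀ (by linarith)]
    nlinarith [Real.pi_pos]

theorem mul_coxeterAngle {i j : B} (h : M i j ≠ 0) : M i j * coxeterAngle M i j = Real.pi := by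
  rw [coxeterAngle]
  field_simp

-- Powers of a product of two reflections have coefficients given by Chebyshev polynomials `S` at `2
-- cos 2θ`, with `θ = π / m`. Those that survive in the `m`-th power vanish, through `S_n(2 cos 2θ)
-- sin 2θ = sin ((n + 1) 2θ)`.
open Polynomial.Chebyshev in
theorem isLiftable_geomReflection (M : CoxeterMatrix B) : M.IsLiftable (geomReflection M) := by
  intro i j
  rcases eq_or_ne i j with rfl | hij
  · rw [M.diagonal, pow_one]
    ext1 v
    exact Module.involutive_reflection (geomCoroot_self M i) v
  rcases eq_or_ne (M i j) 0 with h0 | h0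
  · rw [h0, pow_zero]
  have h2 : 2 ≤ M i j := two_le_of_ne hij h0
  apply LinearEquiv.ext
  intro z
  have key := Module.reflection_mul_reflection_pow_apply (geomCoroot_self M i)
    (geomCoroot_self M j) (M i j) z _ (geomCoroot_mul M i j).symm
  rw [geomReflection, geomReflection, key, LinearEquiv.coe_one, id]
  -- For `m = 2` the factor `sin 2θ` is zero and cannot be cancelled, so this case is computed
  -- directly.
  rcases h2.eq_or_lt with h2 | h3
  · have hc : Real.cos (coxeterAngle M i j) = 0 := by rw [coxeterAngle, ← h2]; simp
    have hc' : Real.cos (coxeterAngle M j i) = 0 := by rw [coxeterAngle, M.symmetric, ← h2]; simp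
    rw [geomCoroot_single, geomCoroot_single, ← h2, hc, hc', Real.cos_two_mul, hc]
    norm_num [S_zero, S_one, S_neg_one]
    module
  · have hs := sin_two_mul_coxeterAngle_ne_zero (M := M) (i := i) (j := j) h3
    have hS := fun n : ℤ => S_two_mul_real_cos (2 * coxeterAngle M i j) n
    have hpi := mul_coxeterAngle h0
    rcases Nat.even_or_odd' (M i j) with ⟨p, hp | hp⟩
    · have e1 : (((M i j : ℕ) : ℤ) - 2) / 2 = p - 1 := by rw [hp]; push_cast; omega
      have e2 : (((M i j : ℕ) : ℤ) - 1) / 2 = p - 1 := by rw [hp]; push_cast; omega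
      have e3 : (S ℝ ((p : ℤ) - 1)).eval (2 * Real.cos (2 * coxeterAngle M i j)) = 0 := by
        have := hS (p - 1)
        have e : ((((p : ℤ) - 1 : ℤ) : ℝ) + 1) * (2 * coxeterAngle M i j) = Real.pi := by
          rw [← hpi, hp]; push_cast; ring
        rw [e, Real.sin_pi] at this
        exact (mul_eq_zero.1 this).resolve_right hs
      rw [e1, e2, e3]
      simp
    · have e1 : (((M i j : ℕ) : ℤ) - 2) / 2 = p - 1 := by rw [hp]; push_cast; omega
      have e2 : (((M i j : ℕ) : ℤ) - 1) / 2 = p := by rw [hp]; push_cast; omega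
      have e3 : (((M i j : ℕ) : ℤ) - 3) / 2 = p - 1 := by rw [hp]; push_cast; omega
      have e4 : ((M i j : ℕ) : ℤ) / 2 = p := by rw [hp]; push_cast; omega
      have e5 : (S ℝ (p : ℤ)).eval (2 * Real.cos (2 * coxeterAngle M i j)) +
          (S ℝ ((p : ℤ) - 1)).eval (2 * Real.cos (2 * coxeterAngle M i j)) = 0 := by
        have h1 := hS p
        have h2 := hS (p - 1)
        have e : (((p : ℤ) : ℝ) + 1) * (2 * coxeterAngle M i j) =
            Real.pi + coxeterAngle M i j := by
          rw [← hpi, hp]; push_cast; ring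
        have e' : ((((p : ℤ) - 1 : ℤ) : ℝ) + 1) * (2 * coxeterAngle M i j) =
            Real.pi - coxeterAngle M i j := by
          rw [← hpi, hp]; push_cast; ring
        rw [e, add_comm, Real.sin_add_pi] at h1
        rw [e', Real.sin_pi_sub] at h2
        refine (mul_eq_zero.1 (?_ : _ * Real.sin (2 * coxeterAngle M i j) = 0)).resolve_right hs
        rw [add_mul, h1, h2, neg_add_cancel]
      rw [e1, e2, e3, e4, e5]
      simp

-- It suffices to follow the simple root `α_i`: its image under the `k`-th power detects the exact
-- order of the product, including infinite order, where `θ = 0` and the coefficient of `α_j` is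
-- `2k`.
open Polynomial.Chebyshev in
theorem dvd_of_geomReflection_pow_eq_one {i j : B} (hij : i ≠ j) {k : ℕ}
    (h : (geomReflection M i * geomReflection M j) ^ k = 1) : M i j ∣ k := by
  have h1 := geomReflection_pow_apply M i j k
  rw [h, LinearEquiv.coe_one, id] at h1
  have ha := DFunLike.congr_fun h1 i
  have hb := DFunLike.congr_fun h1 j
  simp only [Finsupp.add_apply, Finsupp.smul_apply, Finsupp.single_eq_same,
    Finsupp.single_eq_of_ne hij, Finsupp.single_eq_of_ne hij.symm, smul_eq_mul, mul_one, mul_zero,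
    add_zero, zero_add] at ha hb
  rcases eq_or_ne (M i j) 0 with h0 | h0
  · have hc : coxeterAngle M i j = 0 := by rw [coxeterAngle, h0]; simp
    rw [hc] at hb
    simp [S_eval_two] at hb
    simp [hb]
  rcases (two_le_of_ne hij h0).eq_or_lt with h2 | h3
  · have hc : Real.cos (coxeterAngle M i j) = 0 := by rw [coxeterAngle, ← h2]; simp
    rw [Real.cos_two_mul, hc] at ha
    rw [show (2 : ℝ) * (2 * 0 ^ 2 - 1) = -2 by norm_num, S_eval_neg_two, S_eval_neg_two] at ha
    rw [← h2, ← even_iff_two_dvd]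
    by_contra ho
    rw [Nat.not_even_iff_odd] at ho
    have e1 : Int.negOnePow k = -1 := Int.negOnePow_odd _ (by exact_mod_cast ho)
    have e2 : Int.negOnePow (k - 1) = 1 := Int.negOnePow_even _ (by
      rw [Int.even_sub_one, Int.not_even_iff_odd]; exact_mod_cast ho)
    rw [e1, e2] at ha
    norm_num at ha
  · have hs := sin_two_mul_coxeterAngle_ne_zero (M := M) (i := i) (j := j) h3
    have hS := fun n : ℤ => S_two_mul_real_cos (2 * coxeterAngle M i j) n
    have hc : Real.cos (coxeterAngle M i j) ≠ 0 := by
      intro hc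
      rw [Real.sin_two_mul, hc, mul_zero] at hs
      exact hs rfl
    -- The coordinate at `α_j` gives `sin 2kθ = 0`; the coordinate at `α_i` then gives `cos 2kθ =
    -- 1`.
    have hb0 := (mul_eq_zero.1 hb.symm).resolve_right (mul_ne_zero two_ne_zero hc)
    rw [hb0, add_zero] at ha
    have g1 := hS k
    have g2 := hS (k - 1)
    rw [← ha, one_mul, add_mul, one_mul, Real.sin_add] at g1
    rw [hb0, zero_mul] at g2
    push_cast at g1 g2
    rw [sub_add_cancel] at g2
    rw [← g2, zero_mul, zero_add, eq_comm, mul_eq_right₀ hs, Real.cos_eq_one_iff] at g1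
    obtain ⟨n, hn⟩ := g1
    have hm := mul_coxeterAngle h0
    have hne : coxeterAngle M i j ≠ 0 := by
      intro h
      rw [h, mul_zero] at hm
      exact Real.pi_ne_zero hm.symm
    have : (n : ℝ) * M i j = k := by
      apply mul_right_cancel₀ (mul_ne_zero two_ne_zero hne)
      rw [← hn, ← hm]
      ring
    have : n * M i j = k := by exact_mod_cast this
    exact Int.natCast_dvd_natCast.1 ⟨n, by rw [← this, mul_comm]⟩

theorem dvd_of_simple_mul_simple_pow_eq_one {i j : B} (hij : i ≠ j) {k : ℕ}
    (h : (cs.simple i * cs.simple j) ^ k = 1) : M i j ∣ k := by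
  apply dvd_of_geomReflection_pow_eq_one hij
  have := congrArg (cs.lift ⟨geomReflection M, isLiftable_geomReflection M⟩) h
  rwa [map_pow, map_mul, map_one, cs.lift_apply_simple, cs.lift_apply_simple] at this

/-! ### Matsumoto's theorem -/

/-- The reflections attached to positions `k < k' < m` differ by a power of `s_j s_i` with exponent
`k' - k < m`, which is nontrivial by the exact order. Writing the word as a prefix of one of length
`2m` gives access to the closed form of the inversion sequence. -/
theorem isReduced_take_alternatingWord {i j : B} (hij : i ≠ j) {m : ℕ}
    (hm : M i j = 0 ∨ m ≤ M i j) : cs.IsReduced ((alternatingWord i j (2 * m)).take m) := by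
  rw [← isReduced_reverse_iff]
  apply isReduced_of_nodup_rightInvSeq
  rw [rightInvSeq_reverse, List.nodup_reverse, leftInvSeq_take, List.nodup_iff_injective_get]
  have key : ∀ k k' : ℕ, k < k' → k' < m → cs.wordProd (alternatingWord j i (2 * k + 1)) ≠
      cs.wordProd (alternatingWord j i (2 * k' + 1)) := by
    intro k k' hk hk' e
    rw [prod_alternatingWord_eq_mul_pow, prod_alternatingWord_eq_mul_pow,
      if_neg (by simp), if_neg (by simp), show (2 * k + 1) / 2 = k by omega,
      show (2 * k' + 1) / 2 = k + (k' - k) by omega, pow_add, ← mul_assoc, left_eq_mul] at e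
    have hd := cs.dvd_of_simple_mul_simple_pow_eq_one hij.symm e
    rw [M.symmetric j i] at hd
    rcases hm with hm | hm
    · rw [hm, zero_dvd_iff] at hd
      omega
    · have := Nat.le_of_dvd (by omega) hd
      omega
  intro ⟨k, hk⟩ ⟨k', hk'⟩ e
  simp only [List.length_take, length_leftInvSeq, length_alternatingWord, lt_min_iff] at hk hk'
  simp only [List.get_eq_getElem, List.getElem_take] at e
  rw [getElem_leftInvSeq_alternatingWord _ _ _ _ _ hk.2,
    getElem_leftInvSeq_alternatingWord _ _ _ _ _ hk'.2] at e
  rw [Fin.mk.injEq]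
  rcases lt_trichotomy k k' with h | h | h
  · exact absurd e (key _ _ h hk'.1)
  · exact h
  · exact absurd e.symm (key _ _ h hk.1)

theorem isReduced_alternatingWord {i j : B} (hij : i ≠ j) {m : ℕ}
    (hm : M i j = 0 ∨ m ≤ M i j) : cs.IsReduced (alternatingWord i j m) := by
  rcases Nat.eq_zero_or_pos m with rfl | hpos
  · simp [alternatingWord, IsReduced]
  rcases Nat.even_or_odd m with he | ho
  · have := cs.isReduced_take_alternatingWord hij hm
    rwa [listTake_alternatingWord _ _ _ _ (by omega), if_pos he] at this
  · have := cs.isReduced_take_alternatingWord hij.symm (m := m) (by rwa [M.symmetric])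
    rwa [listTake_alternatingWord _ _ _ _ (by omega), if_neg (by simpa using ho)] at this

/-- When the alternating suffix is lengthened by exchange, the deleted letter must lie in the prefix
`c`: a deletion inside the suffix would contradict that the longer alternating word is reduced. -/
theorem exists_append_alternatingWord {w : W} {i j : B} (hij : i ≠ j)
    (hi : cs.IsRightDescent w i) (hj : cs.IsRightDescent w j) {n : ℕ}
    (hn : M i j = 0 ∨ n ≤ M i j) :
    ∃ c : List B, cs.wordProd (c ++ alternatingWord i j n) = w ∧ c.length + n = cs.length w := by
  induction n generalizing i j with
  | zero =>
    obtain ⟨c, hc, rfl⟩ := cs.exists_isReduced w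
    exact ⟨c, by simp [alternatingWord], by simpa using hc.eq.symm⟩
  | succ n ih =>
    obtain ⟨c, hc, hl⟩ := ih hij.symm hj hi (by rw [M.symmetric]; omega)
    have hex : cs.length (cs.wordProd (c ++ alternatingWord j i n) * cs.simple j) <
        cs.length (cs.wordProd (c ++ alternatingWord j i n)) := by rw [hc]; exact hj
    obtain ⟨k, hk, e⟩ := cs.exchange_right hex
    rcases lt_or_ge k c.length with hkc | hkc
    · refine ⟨c.eraseIdx k, ?_, ?_⟩
      · rw [List.eraseIdx_append_of_lt_length hkc] at e
        rw [alternatingWord_succ, List.concat_eq_append, ← List.append_assoc, wordProd_append, ← e,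
          wordProd_singleton, simple_mul_simple_cancel_right, hc]
      · rw [← hl, ← List.length_eraseIdx_add_one hkc]
        ring
    · exfalso
      have hka : k - c.length < (alternatingWord j i n).length := by
        rw [List.length_append] at hk
        omega
      rw [List.eraseIdx_append_of_length_le hkc, wordProd_append, wordProd_append, mul_assoc,
        mul_right_inj] at e
      have h1 := cs.length_wordProd_eraseIdx_le _ hka
      rw [← e, ← wordProd_concat, ← alternatingWord_succ,
        (cs.isReduced_alternatingWord hij hn).eq, length_alternatingWord,
        length_alternatingWord] at h1
      omega

/-- Two reduced words of `w` with different last letters `i`, `j` are linked through two reduced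
words with a common prefix that end in the two sides of the braid relation. Each link shares a last
letter, so cancelling it reduces to smaller length. -/
theorem prod_map_eq_of_wordProd_eq {G : Type*} [Monoid G] (f : B → G)
    (hf : ∀ i j, ((braidWord M i j).map f).prod = ((braidWord M j i).map f).prod)
    {ω ω' : List B} (hω : cs.IsReduced ω) (hω' : cs.IsReduced ω')
    (h : cs.wordProd ω = cs.wordProd ω') : (ω.map f).prod = (ω'.map f).prod := by
  induction hn : ω.length generalizing ω ω' with
  | zero =>
    have h' : ω'.length = 0 := by rw [← hω'.eq, ← h, hω.eq, hn]
    rw [List.length_eq_zero_iff.1 hn, List.length_eq_zero_iff.1 h']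
  | succ n ih =>
    have hn' : ω'.length = n + 1 := by rw [← hω'.eq, ← h, hω.eq, hn]
    obtain ⟨a, i, rfl⟩ : ∃ a i, ω = a ++ [i] := by
      rcases List.eq_nil_or_concat ω with rfl | ⟨a, i, rfl⟩
      · simp at hn
      · exact ⟨a, i, List.concat_eq_append⟩
    obtain ⟨b, j, rfl⟩ : ∃ a i, ω' = a ++ [i] := by
      rcases List.eq_nil_or_concat ω' with rfl | ⟨a, i, rfl⟩
      · simp at hn'
      · exact ⟨a, i, List.concat_eq_append⟩
    have hla : a.length = n := by simpa using hn
    have hlb : b.length = n := by simpa using hn'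
    have ha := hω.of_append_left
    have hb := hω'.of_append_left
    simp only [wordProd_append, wordProd_singleton] at h
    rw [List.map_append, List.map_append, List.prod_append, List.prod_append]
    rcases eq_or_ne i j with rfl | hij
    · rw [ih ha hb (mul_right_cancel h) hla]
    set w := cs.wordProd a * cs.simple i with hw
    have hlw : cs.length w = n + 1 := by
      rw [hw, ← wordProd_singleton, ← wordProd_append, hω.eq, hn]
    have hi : cs.IsRightDescent w i := by
      rw [IsRightDescent, hlw, hw, simple_mul_simple_cancel_right, ha.eq]
      omega
    have hj : cs.IsRightDescent w j := by
      rw [IsRightDescent, hlw, h, simple_mul_simple_cancel_right, hb.eq]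
      omega
    -- If `s_i s_j` had infinite order, `w` would have alternating suffixes longer than `ℓ(w)`.
    have h0 : M i j ≠ 0 := by
      intro h0
      obtain ⟨c, -, hc⟩ := cs.exists_append_alternatingWord hij hi hj (n := n + 2) (Or.inl h0)
      omega
    obtain ⟨p, hp⟩ := Nat.exists_eq_succ_of_ne_zero h0
    have hp' : M j i = p + 1 := by rw [M.symmetric, hp]
    obtain ⟨c, hc, hcl⟩ := cs.exists_append_alternatingWord hij hi hj (n := p + 1)
      (Or.inr hp.ge)
    have hbr : cs.wordProd (alternatingWord i j (p + 1)) =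
        cs.wordProd (alternatingWord j i (p + 1)) := by
      have := cs.wordProd_braidWord_eq i j
      rwa [braidWord, braidWord, hp, hp'] at this
    have hfbr : ((alternatingWord i j (p + 1)).map f).prod =
        ((alternatingWord j i (p + 1)).map f).prod := by
      have := hf i j
      rwa [braidWord, braidWord, hp, hp'] at this
    have hredj : cs.IsReduced ((c ++ alternatingWord j i p) ++ [j]) := by
      rw [List.append_assoc, ← List.concat_eq_append, ← alternatingWord_succ, IsReduced, hc, ← hcl]
      simp
    have hc' : cs.wordProd (c ++ alternatingWord j i (p + 1)) = w := by
      rw [wordProd_append, ← hbr, ← wordProd_append, hc]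
    have hredi : cs.IsReduced ((c ++ alternatingWord i j p) ++ [i]) := by
      rw [List.append_assoc, ← List.concat_eq_append, ← alternatingWord_succ, IsReduced, hc', ← hcl]
      simp
    have ea : (a.map f).prod = ((c ++ alternatingWord i j p).map f).prod := by
      refine ih ha hredi.of_append_left ?_ hla
      rw [← mul_left_inj (cs.simple i), ← hw, ← hc', ← wordProd_singleton, ← wordProd_append,
        alternatingWord_succ, List.concat_eq_append, List.append_assoc]
    have eb : (b.map f).prod = ((c ++ alternatingWord j i p).map f).prod := by
      refine ih hb hredj.of_append_left ?_ hlb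
      rw [← mul_left_inj (cs.simple j), ← h, ← hc, ← wordProd_singleton, ← wordProd_append,
        alternatingWord_succ, List.concat_eq_append, List.append_assoc]
    rw [ea, eb, ← List.prod_append, ← List.prod_append, ← List.map_append, ← List.map_append,
      List.append_assoc, List.append_assoc, ← List.concat_eq_append, ← List.concat_eq_append,
      ← alternatingWord_succ, ← alternatingWord_succ, List.map_append, List.map_append,
      List.prod_append, List.prod_append, hfbr]

end CoxeterSystem

/-! ### Minimal coset representatives -/

namespace ParabolicKL

variable {B W : Type*} [Group W] {M : CoxeterMatrix B} (cs : CoxeterSystem M W) {J : Set B}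

theorem simple_mem_parabolic {i : B} (hi : i ∈ J) : cs.simple i ∈ parabolic cs J :=
  Subgroup.subset_closure ⟨i, hi, rfl⟩

theorem wordProd_mem_parabolic {l : List B} (hl : ∀ i ∈ l, i ∈ J) :
    cs.wordProd l ∈ parabolic cs J := by
  induction l with
  | nil => simp
  | cons i l ih =>
    rw [cs.wordProd_cons]
    exact mul_mem (simple_mem_parabolic cs (hl i (by simp))) (ih fun j hj => hl j (by simp [hj]))

theorem exists_word_of_mem_parabolic {w : W} (hw : w ∈ parabolic cs J) :
    ∃ l : List B, (∀ i ∈ l, i ∈ J) ∧ cs.wordProd l = w := by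
  induction hw using Subgroup.closure_induction with
  | mem x hx =>
    obtain ⟨i, hi, rfl⟩ := hx
    exact ⟨[i], by simpa using hi, by simp⟩
  | one => exact ⟨[], by simp, by simp⟩
  | mul x y _ _ hx hy =>
    obtain ⟨l, hl, rfl⟩ := hx
    obtain ⟨l', hl', rfl⟩ := hy
    exact ⟨l ++ l', by simpa [or_imp, forall_and] using ⟨hl, hl'⟩, cs.wordProd_append _ _⟩
  | inv x _ hx =>
    obtain ⟨l, hl, rfl⟩ := hx
    exact ⟨l.reverse, by simpa using hl, cs.wordProd_reverse _⟩

/-- A word in `J` that is shortest among the words in `J` with the same product. -/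
def IsShortestWord (J : Set B) (l : List B) : Prop :=
  (∀ i ∈ l, i ∈ J) ∧
    ∀ l' : List B, (∀ i ∈ l', i ∈ J) → cs.wordProd l' = cs.wordProd l → l.length ≤ l'.length

theorem exists_isShortestWord {w : W} (hw : w ∈ parabolic cs J) :
    ∃ l : List B, IsShortestWord cs J l ∧ cs.wordProd l = w := by
  classical
  have h : ∃ n, ∃ l : List B, (∀ i ∈ l, i ∈ J) ∧ cs.wordProd l = w ∧ l.length = n := by
    obtain ⟨l, hl, h⟩ := exists_word_of_mem_parabolic cs hw
    exact ⟨_, l, hl, h, rfl⟩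
  obtain ⟨l, hl, hlw, hn⟩ := Nat.find_spec h
  exact ⟨l, ⟨hl, fun l' hl' e => hn ▸ Nat.find_min' h ⟨l', hl', e.trans hlw, rfl⟩⟩, hlw⟩

/-- If adding a letter of `J` on the left lowered the length, exchange would delete a letter either
from the word in `J`, against its minimality, or from the word of `z`, giving a shorter element of
`W_J z`. Minimality is among words in `J` because agreement of this length with `ℓ` on `W_J` is
itself a consequence, namely the case `z = 1`. -/
theorem IsShortestWord.length_mul {l : List B} (hl : IsShortestWord cs J l) {z : W}
    (hz : z ∈ minReps cs J) : cs.length (cs.wordProd l * z) = l.length + cs.length z := by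
  induction l with
  | nil => simp
  | cons i l ih =>
    have hlJ : ∀ j ∈ l, j ∈ J := fun j hj => hl.1 j (by simp [hj])
    have hl' : IsShortestWord cs J l := by
      refine ⟨hlJ, fun l' hl' e => ?_⟩
      have := hl.2 (i :: l') (by simpa using ⟨hl.1 i (by simp), hl'⟩)
        (by rw [cs.wordProd_cons, cs.wordProd_cons, e])
      simpa using this
    have ih := ih hl'
    rw [cs.wordProd_cons, mul_assoc]
    rcases cs.length_simple_mul (cs.wordProd l * z) i with h | h
    · rw [h, ih, List.length_cons]
      ring
    exfalso
    obtain ⟨a, ha, rfl⟩ := cs.exists_isReduced z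
    rw [← cs.wordProd_append] at h
    obtain ⟨k, hk, e⟩ := cs.exchange_left (ω := l ++ a) (i := i) (by omega)
    rcases lt_or_ge k l.length with hkl | hkl
    · rw [List.eraseIdx_append_of_lt_length hkl, cs.wordProd_append, cs.wordProd_append,
        ← mul_assoc, mul_left_inj, ← cs.wordProd_cons] at e
      have := hl.2 (l.eraseIdx k) (fun j hj => hlJ j (List.mem_of_mem_eraseIdx hj)) e.symm
      rw [List.length_cons, ← List.length_eraseIdx_add_one hkl] at this
      omega
    · have hka : k - l.length < a.length := by
        rw [List.length_append] at hk
        omega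
      rw [List.eraseIdx_append_of_length_le hkl, cs.wordProd_append, cs.wordProd_append] at e
      have hz' := hz ((cs.wordProd l)⁻¹ * cs.simple i * cs.wordProd l)
        (mul_mem (mul_mem (inv_mem (wordProd_mem_parabolic cs hlJ))
          (simple_mem_parabolic cs (hl.1 i (by simp)))) (wordProd_mem_parabolic cs hlJ))
      rw [mul_assoc, mul_assoc, e, inv_mul_cancel_left, ha.eq] at hz'
      have := cs.length_wordProd_eraseIdx_le a hka
      omega

theorem length_mul_of_mem_minReps {w z : W} (hw : w ∈ parabolic cs J) (hz : z ∈ minReps cs J) :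
    cs.length (w * z) = cs.length w + cs.length z := by
  obtain ⟨l, hl, rfl⟩ := exists_isShortestWord cs hw
  have h1 : (1 : W) ∈ minReps cs J := fun w _ => by simp
  have h2 := hl.length_mul cs h1
  rw [mul_one, cs.length_one, add_zero] at h2
  rw [hl.length_mul cs hz, h2]

theorem one_mem_minReps : (1 : W) ∈ minReps cs J := fun w _ => by simp

theorem mul_simple_mem_minReps_of_isRightDescent {x : W} {i : B} (hx : x ∈ minReps cs J)
    (h : cs.IsRightDescent x i) : x * cs.simple i ∈ minReps cs J := by
  intro w hw
  have h1 := hx w hw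
  have h2 := cs.isRightDescent_iff.1 h
  have h3 := cs.length_mul_simple (w * x) i
  rw [← mul_assoc]
  omega

/-- The product of two simple reflections on opposite sides of `w` lowers the length of `w s`
only if `s' w = w s`. -/
theorem simple_mul_eq_mul_simple {w : W} {i j : B} (hj : cs.length (w * cs.simple j) = cs.length w + 1)
    (hi : cs.length (cs.simple i * w) = cs.length w + 1)
    (h : cs.length (cs.simple i * (w * cs.simple j)) < cs.length (w * cs.simple j)) :
    cs.simple i * w = w * cs.simple j := by
  obtain ⟨a, ha, rfl⟩ := cs.exists_isReduced w
  rw [← cs.wordProd_singleton j, ← cs.wordProd_append] at h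
  obtain ⟨k, hk, e⟩ := cs.exchange_left h
  rcases lt_or_ge k a.length with hka | hka
  · exfalso
    rw [List.eraseIdx_append_of_lt_length hka, cs.wordProd_append, cs.wordProd_append, ← mul_assoc,
      mul_left_inj] at e
    have := cs.length_wordProd_eraseIdx_le a hka
    rw [← e, hi, ha.eq] at this
    omega
  · have hk' : k = a.length := by simp at hk; omega
    subst hk'
    rw [List.eraseIdx_append_of_length_le le_rfl, Nat.sub_self, cs.wordProd_append,
      List.eraseIdx_zero, List.tail_cons, List.append_nil, cs.wordProd_singleton] at e
    rw [← mul_left_inj (cs.simple j), mul_assoc, e, cs.simple_mul_simple_cancel_right]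

/-- Deodhar's lemma. -/
theorem exists_simple_mul_eq_of_notMem {x : W} {i : B} (hx : x ∈ minReps cs J)
    (h : x * cs.simple i ∉ minReps cs J) :
    ¬ cs.IsRightDescent x i ∧ ∃ j ∈ J, x * cs.simple i = cs.simple j * x := by
  have hd : ¬ cs.IsRightDescent x i := fun hd =>
    h (mul_simple_mem_minReps_of_isRightDescent cs hx hd)
  refine ⟨hd, ?_⟩
  rw [cs.not_isRightDescent_iff] at hd
  simp only [minReps, Set.mem_ofPred_eq, not_forall, not_le] at h
  obtain ⟨w, hw, hlt⟩ := h
  obtain ⟨l, hl, rfl⟩ := exists_isShortestWord cs hw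
  have h1 := hl.length_mul cs hx
  have h2 := cs.length_mul_simple (cs.wordProd l * x) i
  rw [← mul_assoc] at hlt
  -- Here `ℓ(w x s) < ℓ(x) + 1` while `ℓ(w x s) ≥ ℓ(w) + ℓ(x) - 1`, so `w` has length at most 1.
  match l, hl with
  | [], _ => simp at hlt
  | [j], hl =>
    have hj : j ∈ J := hl.1 j (by simp)
    rw [cs.wordProd_singleton] at h1 hlt
    refine ⟨j, hj, (simple_mul_eq_mul_simple cs hd ?_ ?_).symm⟩
    · rw [h1, List.length_singleton, add_comm]
    · rwa [← mul_assoc]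
  | i' :: j' :: l, hl =>
    simp only [List.length_cons] at h1
    omega

/-! ### The Bruhat order -/

theorem BruhatLE.refl (x : W) : BruhatLE cs x x := Relation.ReflTransGen.refl

variable {cs}

theorem BruhatLE.trans {x y z : W} (h : BruhatLE cs x y) (h' : BruhatLE cs y z) :
    BruhatLE cs x z := Relation.ReflTransGen.trans h h'

theorem BruhatLE.length_lt_or_eq {x y : W} (h : BruhatLE cs x y) :
    cs.length x < cs.length y ∨ x = y := by
  induction h with
  | refl => exact Or.inr rfl
  | tail _ h ih =>
    obtain ⟨r, -, -, h⟩ := h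
    rcases ih with ih | rfl
    · exact Or.inl (ih.trans h)
    · exact Or.inl h

theorem BruhatLT.length_lt {x y : W} (h : BruhatLT cs x y) : cs.length x < cs.length y :=
  h.1.length_lt_or_eq.resolve_right h.2

theorem BruhatLE.mul_simple {y : W} {i : B} (h : cs.length y < cs.length (y * cs.simple i)) :
    BruhatLE cs y (y * cs.simple i) :=
  Relation.ReflTransGen.single ⟨cs.simple i, cs.isReflection_simple i, rfl, h⟩

/-- The elements `u s` and `u r s` differ by the reflection `s r s`. If this does not raise the
length, the exchange condition must delete the last letter of `u s`, which forces `u r = u s`. -/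
theorem BruhatLE.lifting_step {u r : W} (hr : cs.IsReflection r) (i : B)
    (h : cs.length u < cs.length (u * r)) :
    BruhatLE cs (u * cs.simple i) (u * r) ∨
      BruhatLE cs (u * cs.simple i) (u * r * cs.simple i) := by
  have hr' : cs.IsReflection (cs.simple i * r * cs.simple i) := by
    have := hr.conj (cs.simple i)
    rwa [cs.inv_simple] at this
  have e : u * r * cs.simple i = u * cs.simple i * (cs.simple i * r * cs.simple i) := by
    simp [mul_assoc]
  rcases lt_or_ge (cs.length (u * cs.simple i)) (cs.length (u * r * cs.simple i)) with hlt | hge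
  · exact Or.inr (Relation.ReflTransGen.single ⟨_, hr', e, hlt⟩)
  left
  have hne : cs.length (u * cs.simple i * (cs.simple i * r * cs.simple i)) ≠
      cs.length (u * cs.simple i) := hr'.length_mul_left_ne _
  rw [← e] at hne
  have h1 := cs.length_mul_simple u i
  have h2 := cs.length_mul_simple (u * r) i
  obtain ⟨a, ha, rfl⟩ := cs.exists_isReduced u
  have hex : cs.length (cs.wordProd (a ++ [i]) * (cs.simple i * r * cs.simple i)) <
      cs.length (cs.wordProd (a ++ [i])) := by
    rw [cs.wordProd_append, cs.wordProd_singleton, ← e]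
    omega
  obtain ⟨k, hk, e'⟩ := cs.strong_exchange hr' hex
  rw [cs.wordProd_append, cs.wordProd_singleton, ← e] at e'
  rcases lt_or_ge k a.length with hka | hka
  · exfalso
    rw [List.eraseIdx_append_of_lt_length hka, cs.wordProd_append, cs.wordProd_singleton,
      mul_left_inj] at e'
    have := cs.length_wordProd_eraseIdx_le a hka
    rw [← e', ← ha.eq] at this
    omega
  · have hk' : k = a.length := by simp at hk; omega
    subst hk'
    rw [List.eraseIdx_append_of_length_le le_rfl, Nat.sub_self, List.eraseIdx_zero, List.tail_cons,
      List.append_nil] at e'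
    have e2 := congrArg (· * cs.simple i) e'
    simp only [cs.simple_mul_simple_cancel_right] at e2
    rw [e2]
    exact BruhatLE.refl cs _

theorem BruhatLE.mul_simple_le {x y : W} {i : B} (h : BruhatLE cs x y)
    (hy : cs.length y < cs.length (y * cs.simple i)) :
    BruhatLE cs (x * cs.simple i) (y * cs.simple i) := by
  have key : BruhatLE cs (x * cs.simple i) y ∨
      BruhatLE cs (x * cs.simple i) (y * cs.simple i) := by
    induction h using Relation.ReflTransGen.head_induction_on with
    | refl => exact Or.inr (BruhatLE.refl cs _)
    | head h h' ih =>
      obtain ⟨r, hr, rfl, hlt⟩ := h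
      rcases BruhatLE.lifting_step hr i hlt with h1 | h1
      · exact Or.inl (h1.trans h')
      · exact ih.imp h1.trans h1.trans
  rcases key with h1 | h1
  · exact h1.trans (BruhatLE.mul_simple hy)
  · exact h1

end ParabolicKL

/-! ### The left regular representation of the Hecke algebra -/

noncomputable section

namespace ParabolicKL

variable {B W : Type*} [Group W] {M : CoxeterMatrix B} (cs : CoxeterSystem M W)

open Classical in
/-- The operator of left multiplication by `T_s` on the free module with basis `W`. -/
def leftOp (i : B) : (W →₀ R) →ₗ[R] (W →₀ R) :=
  Finsupp.linearCombination R fun w =>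
    if cs.IsLeftDescent w i then
      (q - 1) • Finsupp.single w 1 + q • Finsupp.single (cs.simple i * w) 1
    else Finsupp.single (cs.simple i * w) 1

open Classical in
/-- The operator of right multiplication by `T_s` on the free module with basis `W`. -/
def rightOp (i : B) : (W →₀ R) →ₗ[R] (W →₀ R) :=
  Finsupp.linearCombination R fun w =>
    if cs.IsRightDescent w i then
      (q - 1) • Finsupp.single w 1 + q • Finsupp.single (w * cs.simple i) 1
    else Finsupp.single (w * cs.simple i) 1

variable {cs}

theorem leftOp_of_isLeftDescent {w : W} {i : B} (h : cs.IsLeftDescent w i) :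
    leftOp cs i (Finsupp.single w 1) =
      (q - 1) • Finsupp.single w 1 + q • Finsupp.single (cs.simple i * w) 1 := by
  rw [leftOp, Finsupp.linearCombination_single, one_smul, if_pos h]

theorem leftOp_of_not_isLeftDescent {w : W} {i : B} (h : ¬ cs.IsLeftDescent w i) :
    leftOp cs i (Finsupp.single w 1) = Finsupp.single (cs.simple i * w) 1 := by
  rw [leftOp, Finsupp.linearCombination_single, one_smul, if_neg h]

theorem rightOp_of_isRightDescent {w : W} {i : B} (h : cs.IsRightDescent w i) :
    rightOp cs i (Finsupp.single w 1) =
      (q - 1) • Finsupp.single w 1 + q • Finsupp.single (w * cs.simple i) 1 := by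
  rw [rightOp, Finsupp.linearCombination_single, one_smul, if_pos h]

theorem rightOp_of_not_isRightDescent {w : W} {i : B} (h : ¬ cs.IsRightDescent w i) :
    rightOp cs i (Finsupp.single w 1) = Finsupp.single (w * cs.simple i) 1 := by
  rw [rightOp, Finsupp.linearCombination_single, one_smul, if_neg h]

variable (cs)

/-- A left descent can change under right multiplication by a simple reflection only in the square
where exchange forces `s_i w = w s_j`. -/
theorem isLeftDescent_mul_simple_iff {w : W} {i j : B} (hne : cs.simple i * w ≠ w * cs.simple j) :
    cs.IsLeftDescent (w * cs.simple j) i ↔ cs.IsLeftDescent w i := by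
  have h1 := cs.length_mul_simple w j
  have h2 := cs.length_simple_mul w i
  have h3 := cs.length_simple_mul (w * cs.simple j) i
  have h4 := cs.length_mul_simple (cs.simple i * w) j
  rw [mul_assoc] at h4
  rw [CoxeterSystem.IsLeftDescent, CoxeterSystem.IsLeftDescent]
  by_contra hcon
  rcases h1 with h1 | h1 <;> rcases h2 with h2 | h2
  · exact hne (simple_mul_eq_mul_simple cs h1 h2 (by omega))
  · omega
  · omega
  · have e := simple_mul_eq_mul_simple cs (w := w * cs.simple j) (i := i) (j := j)
      (by rw [cs.simple_mul_simple_cancel_right]; omega) (by omega)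
      (by rw [cs.simple_mul_simple_cancel_right]; omega)
    rw [cs.simple_mul_simple_cancel_right] at e
    exact hne (by conv_lhs => rw [← e, cs.simple_mul_simple_cancel_left])

theorem leftOp_rightOp_single (i j : B) (w : W) :
    leftOp cs i (rightOp cs j (Finsupp.single w 1)) =
      rightOp cs j (leftOp cs i (Finsupp.single w 1)) := by
  by_cases hne : cs.simple i * w = w * cs.simple j
  · have hd : cs.IsLeftDescent w i ↔ cs.IsRightDescent w j := by
      rw [CoxeterSystem.IsLeftDescent, CoxeterSystem.IsRightDescent, hne]
    have e1 : cs.simple i * (w * cs.simple j) = w := by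
      rw [← hne, cs.simple_mul_simple_cancel_left]
    by_cases h : cs.IsRightDescent w j
    · have hl := cs.isLeftDescent_iff_not_isLeftDescent_mul.1 (hd.2 h)
      have hr := cs.isRightDescent_iff_not_isRightDescent_mul.1 h
      rw [rightOp_of_isRightDescent h, leftOp_of_isLeftDescent (hd.2 h)]
      simp only [map_add, map_smul]
      rw [leftOp_of_isLeftDescent (hd.2 h), rightOp_of_isRightDescent h, hne,
        rightOp_of_not_isRightDescent hr, leftOp_of_not_isLeftDescent (hne ▸ hl), e1,
        cs.simple_mul_simple_cancel_right]
    · have hr : cs.IsRightDescent (w * cs.simple j) j := by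
        rwa [cs.isRightDescent_iff_not_isRightDescent_mul, cs.simple_mul_simple_cancel_right]
      have hl : cs.IsLeftDescent (w * cs.simple j) i := by
        rwa [cs.isLeftDescent_iff_not_isLeftDescent_mul, e1, hd]
      rw [rightOp_of_not_isRightDescent h, leftOp_of_not_isLeftDescent (mt hd.1 h), hne,
        rightOp_of_isRightDescent hr, leftOp_of_isLeftDescent hl, e1,
        cs.simple_mul_simple_cancel_right]
  · have hL := isLeftDescent_mul_simple_iff cs hne
    have hR : cs.IsRightDescent (cs.simple i * w) j ↔ cs.IsRightDescent w j := by
      have h1 := cs.length_mul_simple w j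
      have h2 := cs.length_simple_mul w i
      have h3 := cs.length_simple_mul (w * cs.simple j) i
      have h4 := cs.length_mul_simple (cs.simple i * w) j
      rw [CoxeterSystem.IsLeftDescent, CoxeterSystem.IsLeftDescent] at hL
      rw [CoxeterSystem.IsRightDescent, CoxeterSystem.IsRightDescent]
      rw [mul_assoc] at h4 ⊢
      omega
    by_cases hl : cs.IsLeftDescent w i <;> by_cases hr : cs.IsRightDescent w j
    · rw [rightOp_of_isRightDescent hr, leftOp_of_isLeftDescent hl]
      simp only [map_add, map_smul]
      rw [leftOp_of_isLeftDescent hl, leftOp_of_isLeftDescent (hL.2 hl),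
        rightOp_of_isRightDescent hr, rightOp_of_isRightDescent (hR.2 hr), mul_assoc]
      module
    · rw [rightOp_of_not_isRightDescent hr, leftOp_of_isLeftDescent hl]
      simp only [map_add, map_smul]
      rw [leftOp_of_isLeftDescent (hL.2 hl),
        rightOp_of_not_isRightDescent hr, rightOp_of_not_isRightDescent (mt hR.1 hr), mul_assoc]
    · rw [rightOp_of_isRightDescent hr, leftOp_of_not_isLeftDescent hl]
      simp only [map_add, map_smul]
      rw [leftOp_of_not_isLeftDescent hl, leftOp_of_not_isLeftDescent (mt hL.1 hl),
        rightOp_of_isRightDescent (hR.2 hr), mul_assoc]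
    · rw [rightOp_of_not_isRightDescent hr, leftOp_of_not_isLeftDescent hl,
        leftOp_of_not_isLeftDescent (mt hL.1 hl), rightOp_of_not_isRightDescent (mt hR.1 hr),
        mul_assoc]

theorem commute_leftOp_rightOp (i j : B) :
    Commute (leftOp cs i : Module.End R (W →₀ R)) (rightOp cs j) := by
  refine Finsupp.lhom_ext' fun w => LinearMap.ext_ring ?_
  exact leftOp_rightOp_single cs i j w

theorem prod_map_leftOp_single_one {ω : List B} (hω : cs.IsReduced ω) :
    (ω.map fun i => (leftOp cs i : Module.End R (W →₀ R))).prod (Finsupp.single 1 1) =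
      Finsupp.single (cs.wordProd ω) 1 := by
  induction ω with
  | nil => simp
  | cons i ω ih =>
    have h : cs.IsReduced ω := hω.of_append_right (ω := [i])
    rw [List.map_cons, List.prod_cons, Module.End.mul_apply, ih h, cs.wordProd_cons,
      leftOp_of_not_isLeftDescent]
    rw [cs.not_isLeftDescent_iff, ← cs.wordProd_cons, hω.eq, h.eq, List.length_cons]

theorem exists_mul_simple_of_ne_one {w : W} (hw : w ≠ 1) :
    ∃ (v : W) (i : B), w = v * cs.simple i ∧ ¬ cs.IsRightDescent v i ∧
      cs.length v + 1 = cs.length w := by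
  obtain ⟨i, hi⟩ := cs.exists_rightDescent_of_ne_one hw
  exact ⟨w * cs.simple i, i, (cs.simple_mul_simple_cancel_right i).symm,
    cs.isRightDescent_iff_not_isRightDescent_mul.1 hi, cs.isRightDescent_iff.1 hi⟩

/-- The right operators generate the whole module from the identity. Relations between left
operators, which commute with them, can thus be tested on one vector; for braid relations that test
is an identity in `W`. -/
theorem eq_of_commute_rightOp {f g : Module.End R (W →₀ R)}
    (hf : ∀ i, Commute f (rightOp cs i)) (hg : ∀ i, Commute g (rightOp cs i))
    (h : f (Finsupp.single 1 1) = g (Finsupp.single 1 1)) : f = g := by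
  refine Finsupp.lhom_ext' fun w => LinearMap.ext_ring ?_
  change f (Finsupp.single w 1) = g (Finsupp.single w 1)
  induction hn : cs.length w using Nat.strong_induction_on generalizing w with
  | _ n ih =>
    by_cases hw : w = 1
    · rwa [hw]
    obtain ⟨v, i, rfl, hv, hl⟩ := exists_mul_simple_of_ne_one cs hw
    have hi := ih _ (by omega) v rfl
    have h1 := congrArg (· (Finsupp.single v 1)) (hf i).eq
    have h2 := congrArg (· (Finsupp.single v 1)) (hg i).eq
    simp only [Module.End.mul_apply] at h1 h2
    rw [rightOp_of_not_isRightDescent hv] at h1 h2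
    rw [h1, h2, hi]

theorem isReduced_braidWord {i j : B} (hij : i ≠ j) :
    cs.IsReduced (CoxeterSystem.braidWord M i j) :=
  cs.isReduced_alternatingWord hij (Or.inr le_rfl)

theorem leftOp_braid (i j : B) :
    ((CoxeterSystem.braidWord M i j).map
      fun i => (leftOp cs i : Module.End R (W →₀ R))).prod =
    ((CoxeterSystem.braidWord M j i).map
      fun i => (leftOp cs i : Module.End R (W →₀ R))).prod := by
  rcases eq_or_ne i j with rfl | hij
  · rfl
  have hc : ∀ (l : List B) (k : B), Commute
      (l.map fun i => (leftOp cs i : Module.End R (W →₀ R))).prod (rightOp cs k) := by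
    intro l k
    refine Commute.list_prod_left _ _ fun f hf => ?_
    obtain ⟨i, -, rfl⟩ := List.mem_map.1 hf
    exact commute_leftOp_rightOp cs i k
  refine eq_of_commute_rightOp cs (hc _) (hc _) ?_
  rw [prod_map_leftOp_single_one cs (isReduced_braidWord cs hij),
    prod_map_leftOp_single_one cs (isReduced_braidWord cs hij.symm), cs.wordProd_braidWord_eq]

theorem leftOp_quadratic (i : B) :
    (leftOp cs i : Module.End R (W →₀ R)) * leftOp cs i = (q - 1) • leftOp cs i + q • 1 := by
  refine Finsupp.lhom_ext' fun w => LinearMap.ext_ring ?_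
  change leftOp cs i (leftOp cs i (Finsupp.single w 1)) =
    (q - 1) • leftOp cs i (Finsupp.single w 1) + q • Finsupp.single w 1
  by_cases h : cs.IsLeftDescent w i
  · have h' := cs.isLeftDescent_iff_not_isLeftDescent_mul.1 h
    conv_lhs => rw [leftOp_of_isLeftDescent h]
    rw [map_add, map_smul, map_smul, leftOp_of_not_isLeftDescent h',
      cs.simple_mul_simple_cancel_left]
  · have h' : cs.IsLeftDescent (cs.simple i * w) i := by
      rwa [cs.isLeftDescent_iff_not_isLeftDescent_mul, cs.simple_mul_simple_cancel_left]
    rw [leftOp_of_not_isLeftDescent h, leftOp_of_isLeftDescent h',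
      cs.simple_mul_simple_cancel_left]

theorem lift_leftOp_rel ⦃x y : FreeAlgebra R B⦄ (h : HeckeRel M x y) :
    FreeAlgebra.lift R (fun i => (leftOp cs i : Module.End R (W →₀ R))) x =
      FreeAlgebra.lift R (fun i => (leftOp cs i : Module.End R (W →₀ R))) y := by
  cases h with
  | quadratic i =>
    rw [map_mul, map_add, map_smul, map_smul, map_one, FreeAlgebra.lift_ι_apply, leftOp_quadratic]
  | braid i j =>
    rw [map_list_prod, map_list_prod, List.map_map, List.map_map]
    have : (FreeAlgebra.lift R (fun i => (leftOp cs i : Module.End R (W →₀ R)))) ∘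
        FreeAlgebra.ι R = fun i => leftOp cs i := funext fun i => FreeAlgebra.lift_ι_apply _ _
    rw [this, leftOp_braid]

/-- The left regular representation of the Hecke algebra, on the free module with basis `W`. -/
def leftRep : Hecke M →ₐ[R] Module.End R (W →₀ R) :=
  RingQuot.liftAlgHom R ⟨FreeAlgebra.lift R fun i => leftOp cs i, lift_leftOp_rel cs⟩

theorem leftRep_Tgen (i : B) : leftRep cs (Tgen M i) = leftOp cs i := by
  refine (RingQuot.liftAlgHom_mkAlgHom_apply R _ (lift_leftOp_rel cs) _).trans ?_
  exact FreeAlgebra.lift_ι_apply _ _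

/-! ### The standard basis elements of the Hecke algebra -/

variable {cs} in
theorem Tstd_eq {ω : List B} (hω : cs.IsReduced ω) :
    Tstd cs (cs.wordProd ω) = (ω.map (Tgen M)).prod := by
  have h := (cs.exists_isReduced (cs.wordProd ω)).choose_spec
  exact cs.prod_map_eq_of_wordProd_eq _ (Tgen_braid M) h.1 hω h.2.symm

theorem Tstd_one : Tstd cs 1 = 1 := by
  have : cs.IsReduced [] := by simp [CoxeterSystem.IsReduced]
  simpa using Tstd_eq this

variable {cs} in
theorem Tstd_mul_simple {w : W} {i : B} (h : ¬ cs.IsRightDescent w i) :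
    Tstd cs (w * cs.simple i) = Tstd cs w * Tgen M i := by
  obtain ⟨ω, hω, rfl⟩ := cs.exists_isReduced w
  rw [cs.not_isRightDescent_iff] at h
  rw [← cs.wordProd_singleton, ← cs.wordProd_append] at h ⊢
  rw [Tstd_eq hω, Tstd_eq (by rw [CoxeterSystem.IsReduced, h, hω.eq, List.length_append,
    List.length_singleton])]
  simp

variable {cs} in
theorem Tstd_simple_mul {w : W} {i : B} (h : ¬ cs.IsLeftDescent w i) :
    Tstd cs (cs.simple i * w) = Tgen M i * Tstd cs w := by
  obtain ⟨ω, hω, rfl⟩ := cs.exists_isReduced w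
  rw [cs.not_isLeftDescent_iff] at h
  rw [← cs.wordProd_cons] at h ⊢
  rw [Tstd_eq hω, Tstd_eq (by rw [CoxeterSystem.IsReduced, h, hω.eq, List.length_cons])]
  simp

end ParabolicKL

end

/-! ### The standard basis of the parabolic module -/

noncomputable section

namespace ParabolicKL

variable {B W : Type*} [Group W] {M : CoxeterMatrix B} (cs : CoxeterSystem M W) (J : Set B)

open Classical in
/-- The functional on the left regular representation that is `q ^ ℓ(w)` at `w ∈ W_J` and
vanishes at the other elements of `W`. -/
def parabolicFunctional : (W →₀ R) →ₗ[R] R :=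
  Finsupp.linearCombination R fun w => if w ∈ parabolic cs J then t (2 * cs.length w) else 0

open Classical in
theorem parabolicFunctional_single (w : W) :
    parabolicFunctional cs J (Finsupp.single w 1) =
      if w ∈ parabolic cs J then t (2 * cs.length w) else 0 := by
  rw [parabolicFunctional, Finsupp.linearCombination_single, one_smul]

variable {J} in
theorem parabolicFunctional_leftOp {i : B} (hi : i ∈ J) (v : W →₀ R) :
    parabolicFunctional cs J (leftOp cs i v) = q * parabolicFunctional cs J v := by
  classical
  suffices h : (parabolicFunctional cs J).comp (leftOp cs i) = q • parabolicFunctional cs J from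
    DFunLike.congr_fun h v
  refine Finsupp.lhom_ext' fun w => LinearMap.ext_ring ?_
  change parabolicFunctional cs J (leftOp cs i (Finsupp.single w 1)) =
    q • parabolicFunctional cs J (Finsupp.single w 1)
  have hmem : cs.simple i * w ∈ parabolic cs J ↔ w ∈ parabolic cs J :=
    Subgroup.mul_mem_cancel_left _ (simple_mem_parabolic cs hi)
  by_cases h : cs.IsLeftDescent w i
  · rw [leftOp_of_isLeftDescent h, map_add, map_smul, map_smul, parabolicFunctional_single,
      parabolicFunctional_single, hmem]
    rw [cs.isLeftDescent_iff] at h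
    split_ifs
    · rw [smul_eq_mul, smul_eq_mul, smul_eq_mul, ← h, sub_mul, t_mul_t, t_mul_t, one_mul]
      have : (2 : ℤ) + 2 * (cs.length (cs.simple i * w) : ℕ) =
        2 * ((cs.length (cs.simple i * w) + 1 : ℕ) : ℤ) := by push_cast; ring
      rw [this, sub_add_cancel]
    · simp
  · rw [leftOp_of_not_isLeftDescent h, parabolicFunctional_single, parabolicFunctional_single,
      hmem]
    rw [cs.not_isLeftDescent_iff] at h
    split_ifs
    · rw [h, smul_eq_mul, t_mul_t]
      congr 1
      push_cast
      ring
    · simp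

/-- A right factor only changes `v`, so with `v` arbitrary it is enough to treat the generators `T_s
- q`. This makes the functional descend to `M^J`. -/
theorem parabolicFunctional_leftRep {h : Hecke M} (hh : h ∈ rightIdeal M J) (v : W →₀ R) :
    parabolicFunctional cs J (leftRep cs h v) = 0 := by
  induction hh using Submodule.span_induction generalizing v with
  | mem x hx =>
    obtain ⟨i, hi, rfl⟩ := hx
    rw [map_sub, map_smul, map_one, leftRep_Tgen, LinearMap.sub_apply, map_sub,
      parabolicFunctional_leftOp cs hi, LinearMap.smul_apply, Module.End.one_apply, map_smul,
      smul_eq_mul, sub_self]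
  | zero => simp
  | add x y _ _ hx hy => rw [map_add, LinearMap.add_apply, map_add, hx, hy, add_zero]
  | smul a x _ hx =>
    rw [← op_unop a, op_smul_eq_mul, map_mul, Module.End.mul_apply, hx]

/-- The functional on `M^J` that extracts, up to a unit, the coefficient of `m_z`. -/
def coeffFunctional (z : W) : ParMod M J →ₗ[R] R where
  toFun := QuotientAddGroup.lift (rightIdeal M J).toAddSubgroup
    ((parabolicFunctional cs J).toAddMonoidHom.comp
      ((LinearMap.applyₗ (R := R) (Finsupp.single z⁻¹ (1 : R))).toAddMonoidHom.comp
        (leftRep cs).toLinearMap.toAddMonoidHom))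
    (fun _ hh => parabolicFunctional_leftRep cs J hh _)
  map_add' := map_add _
  map_smul' r m := by
    obtain ⟨h, rfl⟩ := Submodule.Quotient.mk_surjective _ m
    change parabolicFunctional cs J (leftRep cs (r • h) _) =
      r • parabolicFunctional cs J (leftRep cs h _)
    rw [map_smul, LinearMap.smul_apply, map_smul]

theorem mStd_eq_mk (x : W) : mStd cs J x = Submodule.Quotient.mk (Tstd cs x) := by
  rw [mStd, mOne, ← Submodule.Quotient.mk_smul, op_smul_eq_mul, one_mul]

theorem coeffFunctional_mStd (z x : W) :
    coeffFunctional cs J z (mStd cs J x) =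
      parabolicFunctional cs J (leftRep cs (Tstd cs x) (Finsupp.single z⁻¹ 1)) := by
  rw [mStd_eq_mk]; rfl

-- This evaluates the functional on `T_x T_{w⁻¹}`. It is supported on `w ∈ W_J x`, so the
-- functionals indexed by `W^J` are dual, up to units, to the standard elements.
open Classical in
variable {J} in
theorem parabolicFunctional_leftRep_Tstd {x : W} (hx : x ∈ minReps cs J) (w : W) :
    parabolicFunctional cs J (leftRep cs (Tstd cs x) (Finsupp.single w⁻¹ 1)) =
      if w * x⁻¹ ∈ parabolic cs J then t (2 * cs.length w) else 0 := by
  induction hn : cs.length x using Nat.strong_induction_on generalizing x w with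
  | _ n ih =>
    by_cases h1 : x = 1
    · subst h1
      rw [Tstd_one, map_one, Module.End.one_apply, parabolicFunctional_single, cs.length_inv,
        inv_mem_iff, inv_one, mul_one]
    obtain ⟨v, i, rfl, hv, hl⟩ := exists_mul_simple_of_ne_one cs h1
    have hv' : v ∈ minReps cs J := by
      have hd : cs.IsRightDescent (v * cs.simple i) i := by
        rwa [cs.isRightDescent_iff_not_isRightDescent_mul, cs.simple_mul_simple_cancel_right]
      have := mul_simple_mem_minReps_of_isRightDescent cs hx hd
      rwa [cs.simple_mul_simple_cancel_right] at this
    have ih' := fun w => ih _ (by omega) hv' w rfl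
    -- Lengths are additive on both `W_J v` and `W_J v s`, so right multiplication by `s` raises the
    -- length on the whole coset `W_J v`. This kills the `q - 1` term below.
    have hup : ∀ u : W, u * v⁻¹ ∈ parabolic cs J →
        cs.length (u * cs.simple i) = cs.length u + 1 := by
      intro u hu
      have e1 := length_mul_of_mem_minReps cs hu hv'
      have e2 := length_mul_of_mem_minReps cs hu hx
      rw [inv_mul_cancel_right] at e1
      rw [← mul_assoc, inv_mul_cancel_right] at e2
      omega
    have hmem : w * (v * cs.simple i)⁻¹ = w * cs.simple i * v⁻¹ := by
      rw [mul_inv_rev, cs.inv_simple, mul_assoc]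
    have hsw : cs.simple i * w⁻¹ = (w * cs.simple i)⁻¹ := by rw [mul_inv_rev, cs.inv_simple]
    rw [Tstd_mul_simple hv, map_mul, Module.End.mul_apply, leftRep_Tgen, hmem]
    by_cases hd : cs.IsRightDescent w i
    · rw [leftOp_of_isLeftDescent (cs.isLeftDescent_inv_iff.2 hd), hsw]
      simp only [map_add, map_smul]
      rw [ih', ih', if_neg, smul_zero, zero_add]
      · rw [cs.isRightDescent_iff] at hd
        split_ifs
        · rw [smul_eq_mul, t_mul_t, ← hd]
          congr 1
          push_cast
          ring
        · rw [smul_zero]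
      · intro hw
        have := hup w hw
        rw [CoxeterSystem.IsRightDescent] at hd
        omega
    · rw [leftOp_of_not_isLeftDescent (mt cs.isLeftDescent_inv_iff.1 hd), hsw, ih']
      have hno : w * cs.simple i * v⁻¹ ∉ parabolic cs J := by
        intro hw
        have := hup _ hw
        rw [cs.not_isRightDescent_iff] at hd
        rw [cs.simple_mul_simple_cancel_right] at this
        omega
      rw [if_neg hno, if_neg hno]

theorem eq_of_mul_inv_mem_parabolic {x z : W} (hx : x ∈ minReps cs J) (hz : z ∈ minReps cs J)
    (h : z * x⁻¹ ∈ parabolic cs J) : z = x := by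
  have h1 := length_mul_of_mem_minReps cs h hx
  have h2 := length_mul_of_mem_minReps cs (inv_mem h) hz
  rw [inv_mul_cancel_right] at h1
  rw [mul_inv_rev, inv_inv, inv_mul_cancel_right] at h2
  rw [← mul_inv_eq_one, ← cs.length_eq_zero_iff]
  omega

/-! ### Action of `C'_s` on the normalized standard elements, and the basis property. -/

/-- The normalized standard element `m_x / t ^ ℓ(x)`. -/
def hStd (x : minReps cs J) : ParMod M J := t (-(cs.length (x : W) : ℤ)) • mStd cs J (x : W)

theorem smul_act (r : R) (m : ParMod M J) (h : Hecke M) : (r • m) <• h = r • (m <• h) := by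
  obtain ⟨k, rfl⟩ := Submodule.Quotient.mk_surjective _ m
  rw [← Submodule.Quotient.mk_smul, ← Submodule.Quotient.mk_smul, ← Submodule.Quotient.mk_smul,
    ← Submodule.Quotient.mk_smul, op_smul_eq_mul, op_smul_eq_mul, smul_mul_assoc]

theorem act_smul (r : R) (m : ParMod M J) (h : Hecke M) : m <• (r • h) = r • (m <• h) := by
  obtain ⟨k, rfl⟩ := Submodule.Quotient.mk_surjective _ m
  rw [← Submodule.Quotient.mk_smul, ← Submodule.Quotient.mk_smul,
    ← Submodule.Quotient.mk_smul, op_smul_eq_mul, op_smul_eq_mul, mul_smul_comm]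

theorem act_add (m : ParMod M J) (h k : Hecke M) : m <• (h + k) = m <• h + m <• k := by
  rw [op_add, add_smul]

theorem act_act (m : ParMod M J) (h k : Hecke M) : (m <• h) <• k = m <• (h * k) := by
  rw [op_mul, mul_smul]

theorem mStd_act_of_not_isRightDescent {x : W} {i : B} (h : ¬ cs.IsRightDescent x i) :
    mStd cs J x <• Tgen M i = mStd cs J (x * cs.simple i) := by
  rw [mStd, act_act, ← Tstd_mul_simple h, mStd]

theorem mStd_act_of_isRightDescent {x : W} {i : B} (h : cs.IsRightDescent x i) :
    mStd cs J x <• Tgen M i = (q - 1) • mStd cs J x + q • mStd cs J (x * cs.simple i) := by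
  have h' := cs.isRightDescent_iff_not_isRightDescent_mul.1 h
  have e := mStd_act_of_not_isRightDescent cs J h'
  rw [cs.simple_mul_simple_cancel_right] at e
  rw [← e, act_act, Tgen_mul_self, act_add, act_smul, act_smul, op_one, one_smul]

variable {J} in
theorem mOne_act {i : B} (hi : i ∈ J) : mOne M J <• Tgen M i = q • mOne M J := by
  rw [mOne, ← Submodule.Quotient.mk_smul, ← Submodule.Quotient.mk_smul, op_smul_eq_mul, one_mul,
    Submodule.Quotient.eq]
  exact Submodule.subset_span ⟨i, hi, rfl⟩

variable {J} in
theorem mStd_act_of_eq {x : W} {i j : B} (hj : j ∈ J) (h : ¬ cs.IsRightDescent x i)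
    (e : x * cs.simple i = cs.simple j * x) : mStd cs J x <• Tgen M i = q • mStd cs J x := by
  rw [mStd_act_of_not_isRightDescent cs J h, e, mStd, Tstd_simple_mul, ← act_act, mOne_act hj,
    smul_act, mStd]
  rw [cs.not_isLeftDescent_iff, ← e, cs.not_isRightDescent_iff.1 h]

theorem act_Cgen (m : ParMod M J) (i : B) :
    m <• Cgen M i = t (-1) • (m + m <• Tgen M i) := by
  rw [Cgen, act_smul, act_add, op_one, one_smul]

-- With the normalization, a move from `x` to `x s` always has coefficient 1, and the diagonal
-- coefficient is `t⁻¹` going up, `t` going down and `t + t⁻¹` when `x s` leaves `W^J`. By Deodhar's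
-- lemma these cases are exhaustive.
variable {J} in
theorem hStd_act_up {x : minReps cs J} {i : B} (h : ¬ cs.IsRightDescent (x : W) i)
    (hx : (x : W) * cs.simple i ∈ minReps cs J) :
    hStd cs J x <• Cgen M i = t (-1) • hStd cs J x + hStd cs J ⟨_, hx⟩ := by
  rw [hStd, hStd, act_Cgen, smul_act, mStd_act_of_not_isRightDescent cs J h, smul_add, smul_smul,
    smul_smul, t_mul_t, cs.not_isRightDescent_iff.1 h]
  congr 3
  push_cast
  ring

variable {J} in
theorem hStd_act_down {x : minReps cs J} {i : B} (h : cs.IsRightDescent (x : W) i)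
    (hx : (x : W) * cs.simple i ∈ minReps cs J) :
    hStd cs J x <• Cgen M i = t 1 • hStd cs J x + hStd cs J ⟨_, hx⟩ := by
  rw [hStd, hStd, act_Cgen, smul_act, mStd_act_of_isRightDescent cs J h,
    ← cs.isRightDescent_iff.1 h]
  simp only [smul_add, sub_smul, smul_sub, smul_smul, one_smul, t_mul_t]
  push_cast
  ring_nf
  abel

variable {J} in
theorem hStd_act_stay {x : minReps cs J} {i : B} (hx : (x : W) * cs.simple i ∉ minReps cs J) :
    hStd cs J x <• Cgen M i = t (-1) • hStd cs J x + t 1 • hStd cs J x := by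
  obtain ⟨h, j, hj, e⟩ := exists_simple_mul_eq_of_notMem cs x.2 hx
  rw [hStd, act_Cgen, smul_act, mStd_act_of_eq cs hj h e]
  simp only [smul_add, smul_smul, t_mul_t]
  congr 3
  ring

theorem mOne_eq_hStd : mOne M J = hStd cs J ⟨1, one_mem_minReps cs⟩ := by
  rw [hStd, mStd, Tstd_one, cs.length_one, op_one, one_smul, Nat.cast_zero, neg_zero, t_zero,
    one_smul]

open Classical in
theorem coeffFunctional_hStd (z x : minReps cs J) :
    coeffFunctional cs J z (hStd cs J x) = if x = z then t (cs.length (z : W)) else 0 := by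
  rw [hStd, map_smul, coeffFunctional_mStd, parabolicFunctional_leftRep_Tstd cs x.2]
  by_cases h : x = z
  · rw [if_pos h, h, mul_inv_cancel, if_pos (one_mem _), smul_eq_mul, t_mul_t]
    congr 1
    ring
  · rw [if_neg h, if_neg fun h' => h (Subtype.ext (eq_of_mul_inv_mem_parabolic cs J x.2 z.2 h').symm),
      smul_zero]

theorem linearIndependent_hStd : LinearIndependent R (hStd cs J) := by
  classical
  rw [linearIndependent_iff']
  intro s g hg z hz
  have h := congrArg (coeffFunctional cs J z) hg
  rw [map_sum, map_zero] at h
  simp only [map_smul, coeffFunctional_hStd, smul_ite, smul_zero] at h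
  rw [Finset.sum_ite_eq' s z, if_pos hz, smul_eq_mul] at h
  have h' := congrArg (· * t (-(cs.length (z : W) : ℤ))) h
  simpa only [mul_assoc, t_mul_t, add_neg_cancel, t_zero, mul_one, zero_mul] using h'

variable {J} in
theorem hStd_act_mem_span (x : minReps cs J) (i : B) :
    hStd cs J x <• Cgen M i ∈ Submodule.span R (Set.range (hStd cs J)) := by
  have hm : ∀ z, hStd cs J z ∈ Submodule.span R (Set.range (hStd cs J)) :=
    fun z => Submodule.subset_span ⟨z, rfl⟩
  by_cases hx : (x : W) * cs.simple i ∈ minReps cs J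
  · by_cases h : cs.IsRightDescent (x : W) i
    · rw [hStd_act_down cs h hx]
      exact add_mem (Submodule.smul_mem _ _ (hm x)) (hm _)
    · rw [hStd_act_up cs h hx]
      exact add_mem (Submodule.smul_mem _ _ (hm x)) (hm _)
  · rw [hStd_act_stay cs hx]
    exact add_mem (Submodule.smul_mem _ _ (hm x)) (Submodule.smul_mem _ _ (hm x))

theorem act_mem_span_hStd (h : Hecke M) {m : ParMod M J}
    (hm : m ∈ Submodule.span R (Set.range (hStd cs J))) :
    m <• h ∈ Submodule.span R (Set.range (hStd cs J)) := by
  have hC : ∀ (i : B) {m : ParMod M J}, m ∈ Submodule.span R (Set.range (hStd cs J)) →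
      m <• Cgen M i ∈ Submodule.span R (Set.range (hStd cs J)) := by
    intro i m hm
    induction hm using Submodule.span_induction with
    | mem x hx =>
      obtain ⟨x, rfl⟩ := hx
      exact hStd_act_mem_span cs x i
    | zero => rw [smul_zero]; exact zero_mem _
    | add x y _ _ hx hy => rw [smul_add]; exact add_mem hx hy
    | smul r x _ hx => rw [smul_act]; exact Submodule.smul_mem _ _ hx
  obtain ⟨a, rfl⟩ := RingQuot.mkAlgHom_surjective R (HeckeRel M) h
  change m <• Hecke.mk M a ∈ _
  induction a using FreeAlgebra.induction generalizing m with
  | grade0 r =>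
    have e : Hecke.mk M (algebraMap R _ r) = r • (1 : Hecke M) := by
      rw [AlgHom.commutes, Algebra.algebraMap_eq_smul_one]
    rw [e, act_smul, op_one, one_smul]
    exact Submodule.smul_mem _ _ hm
  | grade1 i =>
    have e : m <• Tgen M i = t 1 • (m <• Cgen M i) - m := by
      rw [act_Cgen, smul_smul, t_mul_t, add_neg_cancel, t_zero, one_smul, add_sub_cancel_left]
    change m <• Tgen M i ∈ _
    rw [e]
    exact sub_mem (Submodule.smul_mem _ _ (hC i hm)) hm
  | mul a b ha hb =>
    rw [map_mul, ← act_act]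
    exact hb (ha hm)
  | add a b ha hb =>
    rw [map_add, act_add]
    exact add_mem (ha hm) (hb hm)

theorem span_hStd : Submodule.span R (Set.range (hStd cs J)) = ⊤ := by
  rw [eq_top_iff]
  rintro m -
  obtain ⟨h, rfl⟩ := Submodule.Quotient.mk_surjective _ m
  have e : (Submodule.Quotient.mk h : ParMod M J) = mOne M J <• h := by
    rw [mOne, ← Submodule.Quotient.mk_smul, op_smul_eq_mul, one_mul]
  rw [e]
  refine act_mem_span_hStd cs J h ?_
  rw [mOne_eq_hStd cs]
  exact Submodule.subset_span ⟨_, rfl⟩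

/-- The basis of `M^J` that consists of the elements `m_x / t ^ ℓ(x)`. -/
def stdBasis : Module.Basis (minReps cs J) R (ParMod M J) :=
  Module.Basis.mk (linearIndependent_hStd cs J) (span_hStd cs J).ge

theorem stdBasis_apply (x : minReps cs J) : stdBasis cs J x = hStd cs J x :=
  Module.Basis.mk_apply _ _ x

end ParabolicKL

end

/-! ### Laurent polynomials with bounded degrees of fixed parity -/

noncomputable section

namespace ParabolicKL

theorem coeff_t (m n : ℤ) : (t m).coeff n = if m = n then 1 else 0 := LaurentPolynomial.T_apply n m

theorem coeff_t_mul (m : ℤ) (f : R) (n : ℤ) : (t m * f).coeff n = f.coeff (n - m) := by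
  have h := AddMonoidAlgebra.coeff_single_mul_apply f (1 : ℤ) m n
  rw [one_mul] at h
  rw [sub_eq_neg_add, ← h]
  rfl

theorem coeff_barR (f : R) (n : ℤ) : (barR f).coeff n = f.coeff (-n) :=
  LaurentPolynomial.invert_apply f n

/-- This form shows both virtues of the correction factor: it agrees with `f` in degrees at least 0,
and it is symmetric, hence bar-invariant. -/
theorem coeff_symPart (f : R) (n : ℤ) : (symPart f).coeff n = f.coeff |n| := by
  rw [symPart, AddMonoidAlgebra.coeff_add, Finsupp.add_apply, coeff_barR, nonnegPart, posPart]
  simp only [Finsupp.filter_apply]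
  rcases lt_or_ge n 0 with h | h
  · rw [if_neg (by omega), if_pos (by omega), abs_of_neg h, zero_add]
  · rw [if_pos h, if_neg (by omega), abs_of_nonneg h, add_zero]

theorem barR_symPart (f : R) : barR (symPart f) = symPart f := by
  ext n
  rw [coeff_barR, coeff_symPart, coeff_symPart, abs_neg]

/-- The Laurent polynomials whose terms have degrees in `{-d, -d + 2, …, d - 2, d}`. -/
def parityBox (d : ℤ) : AddSubgroup R where
  carrier := {f | ∀ n, f.coeff n ≠ 0 → |n| ≤ d ∧ 2 ∣ n - d}
  zero_mem' := fun n h => absurd rfl h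
  add_mem' := by
    intro f g hf hg n h
    rw [AddMonoidAlgebra.coeff_add, Finsupp.add_apply] at h
    by_cases h0 : f.coeff n = 0
    · exact hg n fun h1 => h (by rw [h0, h1, add_zero])
    · exact hf n h0
  neg_mem' := by
    intro f hf n h
    rw [AddMonoidAlgebra.coeff_neg, Finsupp.neg_apply, neg_ne_zero] at h
    exact hf n h

theorem mem_parityBox {d : ℤ} {f : R} :
    f ∈ parityBox d ↔ ∀ n, f.coeff n ≠ 0 → |n| ≤ d ∧ 2 ∣ n - d := Iff.rfl

theorem one_mem_parityBox : (1 : R) ∈ parityBox 0 := by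
  rw [← t_zero, mem_parityBox]
  intro n h
  rw [coeff_t] at h
  have : 0 = n := by by_contra h'; exact h (if_neg h')
  subst this
  simp

theorem symPart_mem_parityBox {d : ℤ} {f : R} (hf : f ∈ parityBox d) :
    symPart f ∈ parityBox d := by
  intro n h
  rw [coeff_symPart] at h
  obtain ⟨h1, h2⟩ := hf _ h
  rw [abs_abs] at h1
  refine ⟨h1, ?_⟩
  rcases abs_cases n with ⟨h3, -⟩ | ⟨h3, -⟩ <;> omega

theorem mul_mem_parityBox {d e : ℤ} {f g : R} (hf : f ∈ parityBox d) (hg : g ∈ parityBox e) :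
    f * g ∈ parityBox (d + e) := by
  intro n h
  rw [AddMonoidAlgebra.coeff_mul] at h
  obtain ⟨a, -, ha⟩ := Finset.exists_ne_zero_of_sum_ne_zero h
  obtain ⟨b, -, hb⟩ := Finset.exists_ne_zero_of_sum_ne_zero ha
  dsimp only at hb
  split_ifs at hb with hab
  · subst hab
    obtain ⟨h1, h2⟩ := hf a (left_ne_zero_of_mul hb)
    obtain ⟨h3, h4⟩ := hg b (right_ne_zero_of_mul hb)
    refine ⟨(abs_add_le a b).trans (add_le_add h1 h3), ?_⟩
    omega
  · exact absurd rfl hb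

theorem t_mul_mem_parityBox {d k : ℤ} {f : R} (hk : |k| = 1) (hf : f ∈ parityBox d) :
    t k * f ∈ parityBox (d + 1) := by
  intro n h
  rw [coeff_t_mul] at h
  obtain ⟨h1, h2⟩ := hf _ h
  rw [abs_le] at h1 ⊢
  rcases eq_or_eq_neg_of_abs_eq hk with rfl | rfl <;> omega

theorem parityBox_le (d : ℤ) : parityBox d ≤ parityBox (d + 2) := by
  intro f hf n h
  obtain ⟨h1, h2⟩ := hf n h
  omega

theorem le_of_coeff_aeval_ne_zero (p : ℤ[X]) {n : ℤ}
    (h : ((Polynomial.aeval q p : R)).coeff n ≠ 0) : n ≤ 2 * p.natDegree := by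
  rw [Polynomial.aeval_eq_sum_range, AddMonoidAlgebra.coeff_sum, Finsupp.finsetSum_apply] at h
  obtain ⟨i, hi, h⟩ := Finset.exists_ne_zero_of_sum_ne_zero h
  rw [AddMonoidAlgebra.coeff_smul, Finsupp.smul_apply] at h
  have h' := right_ne_zero_of_smul h
  rw [q, t, LaurentPolynomial.T_pow, LaurentPolynomial.T_apply] at h'
  have : (i : ℤ) * 2 = n := by by_contra h''; exact h' (if_neg h'')
  rw [Finset.mem_range] at hi
  omega

theorem eq_sum_t (f : R) : f = ∑ n ∈ f.coeff.support, f.coeff n • t n := by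
  ext a
  rw [AddMonoidAlgebra.coeff_sum, Finsupp.finsetSum_apply, Finset.sum_eq_single a]
  · rw [AddMonoidAlgebra.coeff_smul, Finsupp.smul_apply, coeff_t, if_pos rfl, smul_eq_mul, mul_one]
  · intro b _ hb
    rw [AddMonoidAlgebra.coeff_smul, Finsupp.smul_apply, coeff_t, if_neg hb, smul_zero]
  · intro h
    rw [Finsupp.notMem_support_iff.1 h, zero_smul]
    rfl

/-- Multiplication by `t^d` moves the exponents of `f` to even numbers between 0 and `d - 1`, that
is, to powers of `q`. Both the halving and `toNat` are therefore exact. -/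
theorem exists_aeval_eq {d : ℤ} {f : R} (hf : f ∈ parityBox d) (hd : 0 < d)
    (hneg : ∀ n, 0 ≤ n → f.coeff n = 0) :
    ∃ p : ℤ[X], 2 * (p.natDegree : ℤ) + 1 ≤ d ∧ (Polynomial.aeval q p : R) = t d * f := by
  refine ⟨∑ n ∈ f.coeff.support, Polynomial.monomial ((n + d) / 2).toNat (f.coeff n), ?_, ?_⟩
  · have : (∑ n ∈ f.coeff.support,
        Polynomial.monomial ((n + d) / 2).toNat (f.coeff n)).natDegree ≤ ((d - 1) / 2).toNat := by
      refine Polynomial.natDegree_sum_le_of_forall_le _ _ fun n hn => ?_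
      refine (Polynomial.natDegree_monomial_le _).trans ?_
      have hn' : n < 0 := by
        by_contra h
        exact Finsupp.mem_support_iff.1 hn (hneg n (not_lt.1 h))
      omega
    omega
  · conv_rhs => rw [eq_sum_t f, Finset.mul_sum]
    rw [map_sum]
    refine Finset.sum_congr rfl fun n hn => ?_
    obtain ⟨h1, h2⟩ := hf n (Finsupp.mem_support_iff.1 hn)
    rw [abs_le] at h1
    rw [Polynomial.aeval_monomial, mul_smul_comm, t_mul_t, q, t, LaurentPolynomial.T_pow,
      Algebra.smul_def]
    congr 2
    omega

end ParabolicKL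

end

/-! ### Triangularity of the elements `D'` -/

noncomputable section

namespace ParabolicKL

variable {B W : Type*} [Group W] {M : CoxeterMatrix B} (cs : CoxeterSystem M W) (J : Set B)

theorem Dword_append_singleton (s : List B) (i : B) :
    Dword M J (s ++ [i]) = Dword M J s <• Cgen M i := by
  simp [Dword]

theorem barH_Cgen (i : B) : barH M (Cgen M i) = Cgen M i := by
  rw [Cgen, barH_smul, map_add, map_one, barH_Tgen, barR_t, TgenInv, neg_neg, smul_add, smul_sub,
    smul_smul, smul_smul, t_mul_t, mul_sub, t_mul_t, mul_one, smul_add, sub_smul]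
  norm_num
  abel

theorem barM_Dword (s : List B) : barM M J (Dword M J s) = Dword M J s := by
  induction s using List.reverseRecOn with
  | nil => exact barM_mOne M J
  | append_singleton s i ih => rw [Dword_append_singleton, barM_act, ih, barH_Cgen]

variable {J} in
/-- Removing the last letter of a reduced word for an element of `W^J`. -/
theorem minReps_of_append_singleton {s : List B} {i : B} (hs : cs.IsReduced (s ++ [i]))
    (h : cs.wordProd (s ++ [i]) ∈ minReps cs J) :
    cs.IsReduced s ∧ cs.wordProd s ∈ minReps cs J ∧ ¬ cs.IsRightDescent (cs.wordProd s) i ∧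
      cs.wordProd (s ++ [i]) = cs.wordProd s * cs.simple i := by
  have e : cs.wordProd (s ++ [i]) = cs.wordProd s * cs.simple i := by
    rw [cs.wordProd_append, cs.wordProd_singleton]
  have hs' := hs.of_append_left
  have hd : ¬ cs.IsRightDescent (cs.wordProd s) i := by
    rw [cs.not_isRightDescent_iff, ← e, hs.eq, hs'.eq, List.length_append, List.length_singleton]
  refine ⟨hs', ?_, hd, e⟩
  have hd' : cs.IsRightDescent (cs.wordProd s * cs.simple i) i := by
    rwa [cs.isRightDescent_iff_not_isRightDescent_mul, cs.simple_mul_simple_cancel_right]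
  rw [e] at h
  have := mul_simple_mem_minReps_of_isRightDescent cs h hd'
  rwa [cs.simple_mul_simple_cancel_right] at this

theorem stdBasis_repr_hStd (x : minReps cs J) :
    (stdBasis cs J).repr (hStd cs J x) = Finsupp.single x 1 := by
  rw [← stdBasis_apply, Module.Basis.repr_self]

theorem eq_sum_hStd (F : ParMod M J) :
    F = ((stdBasis cs J).repr F).sum fun x r => r • hStd cs J x := by
  conv_lhs => rw [← (stdBasis cs J).linearCombination_repr F]
  rw [Finsupp.linearCombination_apply]
  simp only [stdBasis_apply]

/-! ### Unitriangularity with respect to the length filtration. -/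

/-- The submodule spanned by the standard elements of length less than `n`. -/
def lowerPart (n : ℕ) : Submodule R (ParMod M J) :=
  (Finsupp.supported R R {x : minReps cs J | cs.length (x : W) < n}).comap
    (stdBasis cs J).repr.toLinearMap

variable {J} {cs}

theorem mem_lowerPart {n : ℕ} {F : ParMod M J} :
    F ∈ lowerPart cs J n ↔
      ∀ x : minReps cs J, n ≤ cs.length (x : W) → (stdBasis cs J).repr F x = 0 := by
  rw [lowerPart, Submodule.mem_comap, Finsupp.mem_supported']
  simp

theorem hStd_mem_lowerPart {n : ℕ} {x : minReps cs J} (h : cs.length (x : W) < n) :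
    hStd cs J x ∈ lowerPart cs J n := by
  classical
  rw [mem_lowerPart]
  intro z hz
  rw [stdBasis_repr_hStd, Finsupp.single_apply, if_neg]
  rintro rfl
  omega

theorem lowerPart_mono {m n : ℕ} (h : m ≤ n) : lowerPart cs J m ≤ lowerPart cs J n := by
  intro F hF
  rw [mem_lowerPart] at hF ⊢
  exact fun x hx => hF x (h.trans hx)

theorem lowerPart_induction {n : ℕ} {p : ParMod M J → Prop} (zero : p 0)
    (add : ∀ F G, p F → p G → p (F + G))
    (smul : ∀ (r : R) (x : minReps cs J), cs.length (x : W) < n → p (r • hStd cs J x))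
    {F : ParMod M J} (hF : F ∈ lowerPart cs J n) : p F := by
  rw [eq_sum_hStd cs J F]
  refine Finset.sum_induction _ p add zero fun x hx => smul _ x ?_
  by_contra h
  exact Finsupp.mem_support_iff.1 hx (mem_lowerPart.1 hF x (not_lt.1 h))

theorem act_mem_lowerPart {n : ℕ} {F : ParMod M J} (hF : F ∈ lowerPart cs J n) (i : B) :
    F <• Cgen M i ∈ lowerPart cs J (n + 1) := by
  refine lowerPart_induction (p := fun F => F <• Cgen M i ∈ lowerPart cs J (n + 1)) ?_ ?_ ?_ hF
  · rw [smul_zero]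
    exact zero_mem _
  · intro F G hF hG
    rw [smul_add]
    exact add_mem hF hG
  · intro r x hx
    rw [smul_act]
    refine Submodule.smul_mem _ _ ?_
    have hm : hStd cs J x ∈ lowerPart cs J (n + 1) := hStd_mem_lowerPart (by omega)
    have hl := cs.length_mul_simple (x : W) i
    by_cases hx' : (x : W) * cs.simple i ∈ minReps cs J
    · have hm' : hStd cs J ⟨_, hx'⟩ ∈ lowerPart cs J (n + 1) := hStd_mem_lowerPart (by simp; omega)
      by_cases h : cs.IsRightDescent (x : W) i
      · rw [hStd_act_down cs h hx']
        exact add_mem (Submodule.smul_mem _ _ hm) hm'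
      · rw [hStd_act_up cs h hx']
        exact add_mem (Submodule.smul_mem _ _ hm) hm'
    · rw [hStd_act_stay cs hx']
      exact add_mem (Submodule.smul_mem _ _ hm) (Submodule.smul_mem _ _ hm)

/-- Prefixes of a reduced word of an element of `W^J` stay in `W^J`, so each letter moves the
leading term up with coefficient 1, while `C'_s` raises the remaining lengths by at most one. -/
theorem Dword_sub_hStd_mem {s : List B} (hs : cs.IsReduced s) (h : cs.wordProd s ∈ minReps cs J) :
    Dword M J s - hStd cs J ⟨_, h⟩ ∈ lowerPart cs J s.length := by
  induction s using List.reverseRecOn with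
  | nil =>
    have : Dword M J [] = hStd cs J ⟨_, h⟩ := (mOne_eq_hStd cs J).trans (by simp)
    rw [this, sub_self]
    exact zero_mem _
  | append_singleton s i ih =>
    obtain ⟨hs', h', hd, e⟩ := minReps_of_append_singleton cs hs h
    have h1 := act_mem_lowerPart (ih hs' h') i
    have hx : ((⟨_, h'⟩ : minReps cs J) : W) * cs.simple i ∈ minReps cs J := e ▸ h
    have e' : (⟨_, h⟩ : minReps cs J) = ⟨_, hx⟩ := Subtype.ext e
    have h2 : Dword M J (s ++ [i]) - hStd cs J ⟨_, h⟩ =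
        (Dword M J s - hStd cs J ⟨_, h'⟩) <• Cgen M i + t (-1) • hStd cs J ⟨_, h'⟩ := by
      rw [Dword_append_singleton, smul_sub, hStd_act_up cs hd hx, e']
      abel
    rw [h2, List.length_append, List.length_singleton]
    refine add_mem h1 (Submodule.smul_mem _ _ (hStd_mem_lowerPart ?_))
    simp only [hs'.eq]
    omega

/-- Each standard element is a bar-fixed `Dword` minus shorter terms, to which induction applies; no
explicit formula for the bar involution is needed. -/
theorem barM_mem_lowerPart {n : ℕ} {F : ParMod M J} (hF : F ∈ lowerPart cs J n) :
    barM M J F ∈ lowerPart cs J n := by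
  induction n using Nat.strong_induction_on generalizing F with
  | _ n ih =>
    refine lowerPart_induction (p := fun F => barM M J F ∈ lowerPart cs J n) ?_ ?_ ?_ hF
    · rw [map_zero]
      exact zero_mem _
    · intro F G hF hG
      rw [map_add]
      exact add_mem hF hG
    · intro r x hx
      rw [barM_smul]
      refine Submodule.smul_mem _ _ ?_
      obtain ⟨x, hxJ⟩ := x
      obtain ⟨s, hs, rfl⟩ := cs.exists_isReduced x
      have hD := Dword_sub_hStd_mem hs hxJ
      simp only [hs.eq] at hx
      have e : hStd cs J ⟨_, hxJ⟩ = Dword M J s - (Dword M J s - hStd cs J ⟨_, hxJ⟩) := by abel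
      have e2 : Dword M J s = (Dword M J s - hStd cs J ⟨_, hxJ⟩) + hStd cs J ⟨_, hxJ⟩ := by abel
      have hDs : Dword M J s ∈ lowerPart cs J n := by
        rw [e2]
        exact add_mem (lowerPart_mono hx.le hD) (hStd_mem_lowerPart (by rwa [hs.eq]))
      rw [e, map_sub, barM_Dword]
      exact sub_mem hDs (lowerPart_mono hx.le (ih _ hx hD))

theorem barM_hStd_sub_mem (x : minReps cs J) :
    barM M J (hStd cs J x) - hStd cs J x ∈ lowerPart cs J (cs.length (x : W)) := by
  obtain ⟨x, hxJ⟩ := x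
  obtain ⟨s, hs, rfl⟩ := cs.exists_isReduced x
  have hD := Dword_sub_hStd_mem hs hxJ
  have hb := barM_mem_lowerPart hD
  rw [map_sub, barM_Dword] at hb
  have := sub_mem hD hb
  rw [sub_sub_sub_cancel_left] at this
  rwa [hs.eq]

/-- At an `x` of maximal length in the support, unitriangularity of the bar involution makes the
coefficient symmetric under `t ↔ t⁻¹`. Having no terms of degree at least 0, it has none at all. -/
theorem eq_zero_of_barM_eq {F : ParMod M J} (hF : barM M J F = F)
    (h : ∀ (x : minReps cs J) (n : ℤ), 0 ≤ n → ((stdBasis cs J).repr F x).coeff n = 0) :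
    F = 0 := by
  by_contra h0
  set c := (stdBasis cs J).repr F with hc
  have hne : c.support.Nonempty := by
    rw [Finsupp.support_nonempty_iff]
    simpa [hc] using h0
  obtain ⟨x, hx, hmax⟩ := Finset.exists_max_image c.support (fun z => cs.length (z : W)) hne
  have key : (stdBasis cs J).repr (barM M J F) x = barR (c x) := by
    classical
    conv_lhs => rw [eq_sum_hStd cs J F]
    rw [Finsupp.sum, map_sum, map_sum, Finsupp.finsetSum_apply, Finset.sum_eq_single x]
    · have h1 := mem_lowerPart.1 (barM_hStd_sub_mem x) x le_rfl
      rw [map_sub, Finsupp.sub_apply, sub_eq_zero, stdBasis_repr_hStd,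
        Finsupp.single_eq_same] at h1
      rw [barM_smul, map_smul, Finsupp.smul_apply, h1, smul_eq_mul, mul_one]
    -- Since `ℓ(z) ≤ ℓ(x)`, the correction terms in the bar image of `z` are too short to reach `x`.
    · intro z hz hzx
      have h1 := mem_lowerPart.1 (barM_hStd_sub_mem z) x (hmax z hz)
      rw [map_sub, Finsupp.sub_apply, sub_eq_zero, stdBasis_repr_hStd, Finsupp.single_apply,
        if_neg hzx] at h1
      rw [barM_smul, map_smul, Finsupp.smul_apply, h1, smul_zero]
    · exact fun hx' => absurd hx hx'
  rw [hF] at key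
  apply Finsupp.mem_support_iff.1 hx
  ext n
  rw [AddMonoidAlgebra.coeff_zero, Finsupp.zero_apply]
  rcases le_total 0 n with hn | hn
  · exact h x n hn
  · have h1 := h x (-n) (by omega)
    rw [← hc] at key
    rw [key, coeff_barR]
    exact h1

/-! ### Support and degree bounds -/

variable (cs J) in
/-- The elements whose coefficients are supported on `x ≤ y`, with degrees in
`{-d, -d + 2, …, d}` for `d = ℓ(y) - ℓ(x)`. -/
def boundedPart (y : W) : AddSubgroup (ParMod M J) where
  carrier := {F | ∀ x : minReps cs J, ((stdBasis cs J).repr F x ≠ 0 → BruhatLE cs (x : W) y) ∧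
    (stdBasis cs J).repr F x ∈ parityBox ((cs.length y : ℤ) - cs.length (x : W))}
  zero_mem' := by
    intro x
    rw [map_zero, Finsupp.zero_apply]
    exact ⟨fun h => absurd rfl h, zero_mem _⟩
  add_mem' := by
    intro F G hF hG x
    rw [map_add, Finsupp.add_apply]
    refine ⟨fun h => ?_, add_mem (hF x).2 (hG x).2⟩
    by_cases h0 : (stdBasis cs J).repr F x = 0
    · exact (hG x).1 fun h1 => h (by rw [h0, h1, add_zero])
    · exact (hF x).1 h0
  neg_mem' := by
    intro F hF x
    rw [map_neg, Finsupp.neg_apply, neg_ne_zero]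
    exact ⟨(hF x).1, neg_mem (hF x).2⟩

theorem smul_hStd_mem_boundedPart {x : minReps cs J} {y : W} {r : R}
    (hr : r ∈ parityBox ((cs.length y : ℤ) - cs.length (x : W))) (h : BruhatLE cs (x : W) y) :
    r • hStd cs J x ∈ boundedPart cs J y := by
  classical
  intro z
  rw [map_smul, Finsupp.smul_apply, stdBasis_repr_hStd, Finsupp.single_apply]
  split_ifs with hxz
  · subst hxz
    rw [smul_eq_mul, mul_one]
    exact ⟨fun _ => h, hr⟩
  · rw [smul_zero]
    exact ⟨fun h => absurd rfl h, zero_mem _⟩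

/-- When `y` goes up to `y s`, the bound `d = ℓ(y) - ℓ(x)` becomes `d + 1` at `x`, matching the
factors `t` and `t⁻¹`; at `x s` it becomes `d` or `d + 2`. Supports are controlled by
`BruhatLE.mul_simple_le`. -/
theorem act_mem_boundedPart {F : ParMod M J} {y : W} {i : B} (hF : F ∈ boundedPart cs J y)
    (hy : ¬ cs.IsRightDescent y i) :
    F <• Cgen M i ∈ boundedPart cs J (y * cs.simple i) := by
  rw [cs.not_isRightDescent_iff] at hy
  have hlt : cs.length y < cs.length (y * cs.simple i) := by omega
  rw [eq_sum_hStd cs J F, Finsupp.sum, Finset.smul_sum]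
  refine sum_mem fun x hx => ?_
  have hle := (hF x).1 (Finsupp.mem_support_iff.1 hx)
  have hr := (hF x).2
  set r := (stdBasis cs J).repr F x
  have hle' := hle.trans (BruhatLE.mul_simple hlt)
  have ht : ∀ k : ℤ, |k| = 1 →
      t k • r • hStd cs J x ∈ boundedPart cs J (y * cs.simple i) := by
    intro k hk
    rw [smul_smul]
    refine smul_hStd_mem_boundedPart ?_ hle'
    have := t_mul_mem_parityBox hk hr
    rw [hy]
    convert! this using 1
    congr 1
    push_cast
    ring
  rw [smul_act]
  by_cases hx' : (x : W) * cs.simple i ∈ minReps cs J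
  · have hle2 := hle.mul_simple_le hlt
    by_cases h : cs.IsRightDescent (x : W) i
    · rw [hStd_act_down cs h hx', smul_add, smul_comm]
      refine add_mem (ht 1 (by simp)) (smul_hStd_mem_boundedPart ?_ hle2)
      have := parityBox_le _ hr
      rw [cs.isRightDescent_iff] at h
      rw [hy]
      convert! this using 1
      congr 1
      simp only [← h]
      push_cast
      ring
    · rw [hStd_act_up cs h hx', smul_add, smul_comm]
      refine add_mem (ht (-1) (by simp)) (smul_hStd_mem_boundedPart ?_ hle2)
      rw [cs.not_isRightDescent_iff] at h
      rw [hy]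
      convert! hr using 1
      congr 1
      simp only [h]
      push_cast
      ring
  · rw [hStd_act_stay cs hx', smul_add, smul_comm, smul_comm r (t 1)]
    exact add_mem (ht (-1) (by simp)) (ht 1 (by simp))

theorem Dword_mem_boundedPart {s : List B} (hs : cs.IsReduced s)
    (h : cs.wordProd s ∈ minReps cs J) : Dword M J s ∈ boundedPart cs J (cs.wordProd s) := by
  induction s using List.reverseRecOn with
  | nil =>
    have : Dword M J [] = (1 : R) • hStd cs J ⟨_, h⟩ := by
      rw [one_smul]
      exact (mOne_eq_hStd cs J).trans (by simp)
    rw [this]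
    refine smul_hStd_mem_boundedPart ?_ (BruhatLE.refl cs _)
    rw [sub_self]
    exact one_mem_parityBox
  | append_singleton s i ih =>
    obtain ⟨hs', h', hd, e⟩ := minReps_of_append_singleton cs hs h
    rw [Dword_append_singleton, e]
    exact act_mem_boundedPart (ih hs' h') hd

theorem smul_mem_boundedPart {F : ParMod M J} {x y : W} {r : R} (hF : F ∈ boundedPart cs J x)
    (hr : r ∈ parityBox ((cs.length y : ℤ) - cs.length x)) (h : BruhatLE cs x y) :
    r • F ∈ boundedPart cs J y := by
  intro z
  rw [map_smul, Finsupp.smul_apply, smul_eq_mul]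
  refine ⟨fun h0 => ((hF z).1 (right_ne_zero_of_mul h0)).trans h, ?_⟩
  have := mul_mem_parityBox hr (hF z).2
  rwa [sub_add_sub_cancel] at this

end ParabolicKL

end

/-! ### The algorithm -/

noncomputable section

namespace ParabolicKL

variable {B W : Type*} [Group W] {M : CoxeterMatrix B} {cs : CoxeterSystem M W} {J : Set B}

theorem repr_Dword {s : List B} {x : minReps cs J} (hs : cs.IsReduced s)
    (hx : cs.wordProd s = x) {z : minReps cs J} (hz : cs.length (x : W) ≤ cs.length (z : W)) :
    (stdBasis cs J).repr (Dword M J s) z = Finsupp.single x 1 z := by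
  obtain ⟨x, hxJ⟩ := x
  subst hx
  have h := mem_lowerPart.1 (Dword_sub_hStd_mem hs hxJ) z (hs.eq ▸ hz)
  rwa [map_sub, Finsupp.sub_apply, sub_eq_zero, stdBasis_repr_hStd] at h

/-- The properties of the elements that occur in the algorithm for `y`. -/
def IsStage (y : minReps cs J) (F : ParMod M J) : Prop :=
  barM M J F = F ∧ F ∈ boundedPart cs J (y : W) ∧ (stdBasis cs J).repr F y = 1

theorem isStage_Dword {y : minReps cs J} {s : List B} (hs : cs.IsReduced s)
    (hy : cs.wordProd s = y) : IsStage y (Dword M J s) := by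
  refine ⟨barM_Dword J s, ?_, ?_⟩
  · rw [← hy]
    exact Dword_mem_boundedPart hs (hy ▸ y.2)
  · rw [repr_Dword hs hy le_rfl, Finsupp.single_eq_same]

/-- The correction factor is bar-invariant with exponents bounded by `ℓ(y) - ℓ(x)`, the `Dword` of
`x` has bounds relative to `x`, and bounds add under multiplication. The coefficient at `y` is
untouched because `x` is shorter. -/
theorem IsStage.step {y : minReps cs J} {F F' : ParMod M J} (hF : IsStage y F)
    (h : Step (stdBasis cs J) y F F') : IsStage y F' := by
  classical
  obtain ⟨x, ⟨hxy, -⟩, -, s, hs, hx, rfl⟩ := h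
  obtain ⟨h1, h2, h3⟩ := hF
  refine ⟨?_, ?_, ?_⟩
  · rw [map_sub, barM_smul, barR_symPart, barM_Dword, h1]
  · refine sub_mem h2 (smul_mem_boundedPart (x := (x : W)) ?_ (symPart_mem_parityBox (h2 x).2) hxy.1)
    rw [← hx]
    exact Dword_mem_boundedPart hs (hx ▸ x.2)
  · rw [map_sub, Finsupp.sub_apply, h3, map_smul, Finsupp.smul_apply,
      repr_Dword hs hx hxy.length_lt.le, Finsupp.single_apply, if_neg, smul_zero, sub_zero]
    exact fun h => hxy.2 (congrArg Subtype.val h)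

theorem IsStage.of_reflTransGen {y : minReps cs J} {F F' : ParMod M J} (hF : IsStage y F)
    (h : Relation.ReflTransGen (Step (stdBasis cs J) y) F F') : IsStage y F' := by
  induction h with
  | refl => exact hF
  | tail _ h ih => exact ih.step h

/-! ### Termination of the procedure. -/

theorem finite_offending (y : minReps cs J) (F : ParMod M J) :
    {x | Offending (stdBasis cs J) y F x}.Finite := by
  refine ((stdBasis cs J).repr F).hasFiniteSupport.subset ?_
  rintro x ⟨-, n, -, h⟩ h0
  exact h (by rw [h0]; rfl)

theorem exists_step_iff (y : minReps cs J) (F : ParMod M J) :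
    (∃ x, Offending (stdBasis cs J) y F x) ↔ ∃ F', Step (stdBasis cs J) y F F' := by
  refine ⟨fun ⟨x₀, hx₀⟩ => ?_, fun ⟨_, x, hx, _⟩ => ⟨x, hx⟩⟩
  obtain ⟨x, hx, hmax⟩ := Set.exists_max_image _ (fun z : minReps cs J => cs.length (z : W))
    (finite_offending y F) ⟨x₀, hx₀⟩
  obtain ⟨s, hs, e⟩ := cs.exists_isReduced (x : W)
  exact ⟨_, x, hx, hmax, s, hs, e.symm, rfl⟩

/-- The multiset of the lengths of the elements that the algorithm still has to treat. -/
def offendingLengths (y : minReps cs J) (F : ParMod M J) : Multiset ℕ :=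
  (finite_offending y F).toFinset.val.map fun x : minReps cs J => cs.length (x : W)

theorem val_eq_inter_add_sdiff {α : Type*} [DecidableEq α] (s t : Finset α) :
    s.val = (s ∩ t).val + (s \ t).val := by
  rw [← Finset.disjUnion_val _ _ (Finset.disjoint_sdiff_inter s t).symm, Finset.disjUnion_eq_union,
    Finset.union_comm, Finset.sdiff_union_inter]

/-- The coefficient at `x` loses its terms of degree at least 0, and other coefficients at length at
least `ℓ(x)` do not change. Every newly offending element is thus shorter than `x`, which is
removed. -/
theorem isDershowitzMannaLT_of_step {y : minReps cs J} {F F' : ParMod M J}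
    (h : Step (stdBasis cs J) y F F') :
    Multiset.IsDershowitzMannaLT (offendingLengths y F') (offendingLengths y F) := by
  classical
  obtain ⟨x, hx, hmax, s, hs, hxs, rfl⟩ := h
  set F' := F - symPart ((stdBasis cs J).repr F x) • Dword M J s with hF'
  set S := (finite_offending y F).toFinset with hS
  set S' := (finite_offending y F').toFinset with hS'
  have hmem : ∀ z, z ∈ S ↔ Offending (stdBasis cs J) y F z := fun z => by simp [hS]
  have hmem' : ∀ z, z ∈ S' ↔ Offending (stdBasis cs J) y F' z := fun z => by simp [hS']
  have hrepr : ∀ z : minReps cs J, cs.length (x : W) ≤ cs.length (z : W) →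
      (stdBasis cs J).repr F' z = (stdBasis cs J).repr F z -
        symPart ((stdBasis cs J).repr F x) * Finsupp.single x 1 z := by
    intro z hz
    rw [hF', map_sub, Finsupp.sub_apply, map_smul, Finsupp.smul_apply, repr_Dword hs hxs hz,
      smul_eq_mul]
  have hx' : x ∉ S' := by
    rw [hmem']
    rintro ⟨-, n, hn, h⟩
    rw [hrepr x le_rfl, Finsupp.single_eq_same, mul_one, AddMonoidAlgebra.coeff_sub,
      Finsupp.sub_apply, coeff_symPart, abs_of_nonneg hn, sub_self] at h
    exact h rfl
  -- The three multisets are the lengths that persist, those that appear and those that disappear.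
  refine ⟨((S ∩ S').val.map fun z : minReps cs J => cs.length (z : W)),
    ((S' \ S).val.map fun z : minReps cs J => cs.length (z : W)),
    ((S \ S').val.map fun z : minReps cs J => cs.length (z : W)), ?_, ?_, ?_, ?_⟩
  · have : cs.length (x : W) ∈ (S \ S').val.map fun z : minReps cs J => cs.length (z : W) :=
      Multiset.mem_map_of_mem _ (Finset.mem_sdiff.2 ⟨(hmem x).2 hx, hx'⟩)
    intro h0
    rw [h0] at this
    exact Multiset.notMem_zero _ this
  · rw [offendingLengths, ← Multiset.map_add, ← hS', Finset.inter_comm, ← val_eq_inter_add_sdiff]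
  · rw [offendingLengths, ← Multiset.map_add, ← hS, ← val_eq_inter_add_sdiff]
  · intro l hl
    obtain ⟨z, hz, rfl⟩ := Multiset.mem_map.1 hl
    obtain ⟨hz', hz⟩ := Finset.mem_sdiff.1 hz
    refine ⟨cs.length (x : W),
      Multiset.mem_map_of_mem _ (Finset.mem_sdiff.2 ⟨(hmem x).2 hx, hx'⟩), ?_⟩
    by_contra hle
    have hzx : x ≠ z := fun h => hx' (h ▸ hz')
    rw [hmem] at hz
    rw [hmem'] at hz'
    obtain ⟨hlt, n, hn, h⟩ := hz'
    rw [hrepr z (not_lt.1 hle), Finsupp.single_apply, if_neg hzx, mul_zero, sub_zero] at h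
    exact hz ⟨hlt, n, hn, h⟩

theorem wellFounded_step (y : minReps cs J) :
    WellFounded (flip (Step (stdBasis cs J) y)) :=
  Subrelation.wf (fun h => isDershowitzMannaLT_of_step h)
    (InvImage.wf (offendingLengths y) Multiset.wellFounded_isDershowitzMannaLT)

/-! ### Kazhdan–Lusztig elements -/

theorem mStd_eq_smul_hStd (x : minReps cs J) :
    mStd cs J (x : W) = t (cs.length (x : W)) • hStd cs J x := by
  rw [hStd, smul_smul, t_mul_t, add_neg_cancel, t_zero, one_smul]

theorem repr_of_eq_sum {y : minReps cs J} {C : ParMod M J} {P : minReps cs J →₀ ℤ[X]}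
    (hC : C = t (-(cs.length (y : W) : ℤ)) •
        P.sum fun x p => (Polynomial.aeval q p : R) • mStd cs J (x : W)) (x : minReps cs J) :
    (stdBasis cs J).repr C x =
      t ((cs.length (x : W) : ℤ) - cs.length (y : W)) * Polynomial.aeval q (P x) := by
  classical
  rw [hC, map_smul, Finsupp.smul_apply, Finsupp.sum, map_sum, Finsupp.finsetSum_apply,
    Finset.sum_eq_single x]
  · rw [mStd_eq_smul_hStd, map_smul, map_smul, stdBasis_repr_hStd, Finsupp.smul_apply,
      Finsupp.smul_apply, Finsupp.single_eq_same, smul_eq_mul, smul_eq_mul, smul_eq_mul, mul_one,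
      mul_comm (Polynomial.aeval q (P x)), ← mul_assoc, t_mul_t, neg_add_eq_sub]
  · intro z _ hz
    rw [mStd_eq_smul_hStd, map_smul, map_smul, stdBasis_repr_hStd, Finsupp.smul_apply,
      Finsupp.smul_apply, Finsupp.single_apply, if_neg hz, smul_zero, smul_zero]
  · intro hx
    rw [Finsupp.notMem_support_iff.1 hx, map_zero, zero_smul, map_zero, Finsupp.zero_apply]

theorem IsKLElement.repr_self {y : minReps cs J} {C : ParMod M J} (hC : IsKLElement cs J y C) :
    (stdBasis cs J).repr C y = 1 := by
  obtain ⟨-, P, -, h2, -, h4⟩ := hC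
  rw [repr_of_eq_sum h4, h2, map_one, sub_self, t_zero, mul_one]

theorem IsKLElement.coeff_repr {y : minReps cs J} {C : ParMod M J} (hC : IsKLElement cs J y C)
    {x : minReps cs J} (hx : x ≠ y) {n : ℤ} (hn : 0 ≤ n) :
    ((stdBasis cs J).repr C x).coeff n = 0 := by
  obtain ⟨-, P, h1, -, h3, h4⟩ := hC
  rw [repr_of_eq_sum h4, coeff_t_mul]
  by_contra h
  by_cases h0 : P x = 0
  · rw [h0, map_zero] at h
    exact h rfl
  have h5 := h3 x ⟨h1 x h0, fun h => hx (Subtype.ext h)⟩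
  have h6 := le_of_coeff_aeval_ne_zero _ h
  omega

/-- The coefficients 1 at `y` cancel in the difference, which is bar-fixed with only negative
degrees. -/
theorem IsKLElement.eq {y : minReps cs J} {C C' : ParMod M J} (hC : IsKLElement cs J y C)
    (hC' : IsKLElement cs J y C') : C' = C := by
  rw [← sub_eq_zero]
  refine eq_zero_of_barM_eq (cs := cs) (by rw [map_sub, hC.1, hC'.1]) fun x n hn => ?_
  rw [map_sub, Finsupp.sub_apply]
  rcases eq_or_ne x y with rfl | hx
  · rw [hC.repr_self, hC'.repr_self, sub_self]
    rfl
  · rw [AddMonoidAlgebra.coeff_sub, Finsupp.sub_apply, hC.coeff_repr hx hn, hC'.coeff_repr hx hn,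
      sub_zero]

theorem IsKLElement.not_offending {y : minReps cs J} {C : ParMod M J} (hC : IsKLElement cs J y C)
    (x : minReps cs J) : ¬ Offending (stdBasis cs J) y C x := by
  rintro ⟨hlt, n, hn, h⟩
  exact h (hC.coeff_repr (fun e => hlt.2 (congrArg Subtype.val e)) hn)

theorem IsStage.isKLElement {y : minReps cs J} {F : ParMod M J} (hF : IsStage y F)
    (h : ∀ x, ¬ Offending (stdBasis cs J) y F x) : IsKLElement cs J y F := by
  classical
  obtain ⟨hbar, hbd, hy⟩ := hF
  -- The last clause, `p = 0` where the coefficient vanishes, makes the chosen family finitely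
  -- supported.
  have hp : ∀ x : minReps cs J, ∃ p : ℤ[X],
      (Polynomial.aeval q p : R) =
        t ((cs.length (y : W) : ℤ) - cs.length (x : W)) * (stdBasis cs J).repr F x ∧
      (BruhatLT cs (x : W) y → 2 * p.natDegree + cs.length (x : W) + 1 ≤ cs.length (y : W)) ∧
      (x = y → p = 1) ∧ ((stdBasis cs J).repr F x = 0 → p = 0) := by
    intro x
    by_cases h0 : (stdBasis cs J).repr F x = 0
    · refine ⟨0, by rw [h0, map_zero, mul_zero], fun hlt => ?_, ?_, fun _ => rfl⟩
      · have := hlt.length_lt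
        simp only [Polynomial.natDegree_zero]
        omega
      · rintro rfl
        rw [hy] at h0
        exact absurd h0 one_ne_zero
    rcases eq_or_ne x y with rfl | hx
    · exact ⟨1, by rw [hy, sub_self, t_zero, map_one, mul_one], fun hlt => absurd rfl hlt.2,
        fun _ => rfl, fun h => absurd h h0⟩
    have hlt : BruhatLT cs (x : W) y := ⟨(hbd x).1 h0, fun e => hx (Subtype.ext e)⟩
    have hl := hlt.length_lt
    obtain ⟨p, hp1, hp2⟩ := exists_aeval_eq (hbd x).2 (by omega) fun n hn => by
      by_contra hne
      exact h x ⟨hlt, n, hn, hne⟩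
    exact ⟨p, hp2, fun _ => by omega, fun e => absurd e hx, fun e => absurd e h0⟩
  choose p hp1 hp2 hp3 hp4 using hp
  have hsupp : ∀ x, p x ≠ 0 → x ∈ ((stdBasis cs J).repr F).support := fun x hx =>
    Finsupp.mem_support_iff.2 fun h0 => hx (hp4 x h0)
  refine ⟨hbar, Finsupp.onFinset _ p hsupp, fun x hx => ?_, hp3 y rfl, hp2, ?_⟩
  · exact (hbd x).1 (Finsupp.mem_support_iff.1 (hsupp x hx))
  · rw [Finsupp.onFinset_sum _ (by simp), Finset.smul_sum]
    conv_lhs => rw [eq_sum_hStd cs J F]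
    refine Finset.sum_congr rfl fun x _ => ?_
    rw [hp1, mStd_eq_smul_hStd, smul_smul, smul_smul, mul_comm _ (t (cs.length (x : W))),
      ← mul_assoc, ← mul_assoc, t_mul_t, t_mul_t]
    have : (cs.length (x : W) : ℤ) + -(cs.length (y : W)) +
      ((cs.length (y : W) : ℤ) - cs.length (x : W)) = 0 := by ring
    rw [this, t_zero, one_mul]

theorem exists_isKLElement (y : minReps cs J) : ∃ C, IsKLElement cs J y C := by
  obtain ⟨s, hs, e⟩ := cs.exists_isReduced (y : W)
  -- A stage that is minimal for the step relation admits no further step, hence has no offending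
  -- coefficient.
  obtain ⟨C, hC, hmin⟩ := (wellFounded_step y).has_min {F | IsStage y F}
    ⟨_, isStage_Dword hs e.symm⟩
  refine ⟨C, IsStage.isKLElement hC fun x hx => ?_⟩
  obtain ⟨F', hF'⟩ := (exists_step_iff y C).1 ⟨x, hx⟩
  exact hmin F' (IsStage.step hC hF') hF'

end ParabolicKL

end

theorem mainTheorem2 {B W : Type*} [Group W] {M : CoxeterMatrix B} (cs : CoxeterSystem M W)
    (J : Set B) :
    ∃ b : Module.Basis (ParabolicKL.minReps cs J) ParabolicKL.R (ParabolicKL.ParMod M J),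
      (∀ x : ParabolicKL.minReps cs J,
        b x = ParabolicKL.t (-(cs.length (x : W) : ℤ)) • ParabolicKL.mStd cs J (x : W)) ∧
      ∀ y : ParabolicKL.minReps cs J,
        ∃ C : ParabolicKL.ParMod M J,
          (∀ C' : ParabolicKL.ParMod M J, ParabolicKL.IsKLElement cs J y C' ↔ C' = C) ∧
          ∀ s : List B, cs.IsReduced s → cs.wordProd s = y →
            (¬ ∃ F : ℕ → ParabolicKL.ParMod M J,
              F 0 = ParabolicKL.Dword M J s ∧
                ∀ n, ParabolicKL.Step b y (F n) (F (n + 1))) ∧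
            ∀ F : ParabolicKL.ParMod M J,
              Relation.ReflTransGen (ParabolicKL.Step b y) (ParabolicKL.Dword M J s) F →
                ((∀ x, ¬ ParabolicKL.Offending b y F x) ↔ F = C) ∧
                ((∃ x, ParabolicKL.Offending b y F x) ↔ ∃ F', ParabolicKL.Step b y F F') := by
  refine ⟨ParabolicKL.stdBasis cs J, ParabolicKL.stdBasis_apply cs J, fun y => ?_⟩
  obtain ⟨C, hC⟩ := ParabolicKL.exists_isKLElement y
  refine ⟨C, fun C' => ⟨hC.eq, fun h => h ▸ hC⟩, fun s hs hy => ⟨?_, fun F hF => ⟨⟨?_, ?_⟩, ?_⟩⟩⟩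
  -- Termination is the absence of infinite runs, which covers all choices of `x` and of reduced
  -- words at once.
  · rintro ⟨F, -, hF⟩
    have : IsWellFounded _ (flip (ParabolicKL.Step (ParabolicKL.stdBasis cs J) y)) :=
      ⟨ParabolicKL.wellFounded_step y⟩
    obtain ⟨n, hn⟩ := WellFounded.not_rel_apply_succ
      (r := flip (ParabolicKL.Step (ParabolicKL.stdBasis cs J) y)) F
    exact hn (hF n)
  · exact fun h => hC.eq (((ParabolicKL.isStage_Dword hs hy).of_reflTransGen hF).isKLElement h)
  · rintro rfl x
    exact hC.not_offending x
  · exact ParabolicKL.exists_step_iff y F
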